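/- For an integer $n\ge 2$ and a complex number $\beta$ with $|\beta|\le 1$, let $S(n,\beta)$ be the set of complex polynomials $P$ of degree $n$ that have all their roots in the closed unit disk and satisfy $P(\beta)=0$. Let $|P|_\beta$ be the distance between $\beta$ and the closest root of the derivative $P'$, and let $r_n(\beta)=\sup\{|P|_\beta : P\in S(n,\beta)\}$. In what follows $\beta$ is real, $\beta\le 1$, the $O$-terms refer to $\beta\to 1$, and their implied constants may depend on $n$. For all $n\ge 2$, $$r_n(\beta)\le 1-\tfrac{3}{10}(1-\beta)+O\big((1-\beta)^2\big).$$ Moreover, for $n=5$ the linear coefficient is attained: $$r_5(\beta)=1-\tfrac{3}{10}(1-\beta)+O\big((1-\beta)^2\big).$$ Consequently this is the best linear bound independent of $n$: if $c$ is a real number such that $r_n(\beta)\le 1-c(1-\beta)+O\big((1-\beta)^2\big)$ for every $n\ge 2$, then $c\le \tfrac{3}{10}$. -/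

import Mathlib

open Filter Topology

/-- `SendovClass n β` is the set `S(n, β)` of complex polynomials of degree `n` all of whose roots
lie in the closed unit disk and which have a root at `β`. -/
def SendovClass (n : ℕ) (β : ℂ) : Set (Polynomial ℂ) :=
  {P | P.degree = n ∧ (∀ z : ℂ, P.IsRoot z → ‖z‖ ≤ 1) ∧ P.IsRoot β}

/-- `critDist P β` is `|P|_β`: the distance between `β` and the closest root of the derivative
`P'`. (If `deg P ≥ 2`, the roots of `P'` form a nonempty finite set, so the infimum is a
minimum.) -/
noncomputable def critDist (P : Polynomial ℂ) (β : ℂ) : ℝ :=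
  Metric.infDist β {ζ : ℂ | P.derivative.IsRoot ζ}

/-- The Sendov radius `r_n(β) = sup {|P|_β : P ∈ S(n, β)}`. For `n ≥ 2` and `‖β‖ ≤ 1` this is the
supremum of a nonempty bounded set, see `sendovRadius_isLUB`. -/
noncomputable def sendovRadius (n : ℕ) (β : ℂ) : ℝ :=
  sSup ((fun P => critDist P β) '' SendovClass n β)

/-- For `n ≥ 2` and `‖β‖ ≤ 1` the supremum that defines `r_n(β)` is a genuine one. -/
theorem sendovRadius_isLUB (n : ℕ) (hn : 2 ≤ n) (β : ℂ) (hβ : ‖β‖ ≤ 1) :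
    IsLUB ((fun P => critDist P β) '' SendovClass n β) (sendovRadius n β) := by
  refine isLUB_csSup ?_ ?_
  · refine ⟨_, (Polynomial.X - Polynomial.C β) ^ n, ⟨?_, ?_, ?_⟩, rfl⟩
    · rw [Polynomial.degree_pow, Polynomial.degree_X_sub_C]; simp
    · intro z hz
      have h : z - β = 0 := by
        have : (z - β) ^ n = 0 := by simpa [Polynomial.IsRoot.def] using hz
        exact pow_eq_zero_iff (by omega) |>.1 this
      rw [sub_eq_zero.1 h]; exact hβ
    · have : n ≠ 0 := by omega
      simp [Polynomial.IsRoot.def, this]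
  · refine ⟨2, ?_⟩
    rintro _ ⟨P, ⟨hd, hr, -⟩, rfl⟩
    have hnd : P.natDegree = n := Polynomial.natDegree_eq_of_degree_eq_some hd
    have hP0 : P ≠ 0 := by
      rintro rfl
      simp at hnd
      omega
    have hdn : P.derivative.natDegree = n - 1 := by
      rw [Polynomial.natDegree_derivative, hnd]
    have hd0 : P.derivative ≠ 0 := by
      intro h
      rw [h] at hdn
      simp at hdn
      omega
    obtain ⟨ζ, hζ⟩ := Complex.exists_root (f := P.derivative)
      (Polynomial.natDegree_pos_iff_degree_pos.1 (by omega))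
    have hζ1 : ‖ζ‖ ≤ 1 := by
      have h := Polynomial.rootSet_derivative_subset_convexHull_rootSet (P := P) (Polynomial.natDegree_pos_iff_degree_pos.1 (by omega))
        ((Polynomial.mem_rootSet_of_ne hd0).2 (by simpa using hζ))
      have h2 : convexHull ℝ (P.rootSet ℂ) ⊆ Metric.closedBall (0 : ℂ) 1 := by
        refine convexHull_min ?_ (convex_closedBall _ _)
        intro z hz
        have := (Polynomial.mem_rootSet_of_ne hP0).1 hz
        simpa using hr z (by simpa using this)
      simpa using h2 h
    calc critDist P β ≤ dist β ζ := Metric.infDist_le_dist_of_mem hζ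
      _ = ‖β - ζ‖ := dist_eq_norm _ _
      _ ≤ ‖β‖ + ‖ζ‖ := norm_sub_le _ _
      _ ≤ 2 := by linarith

/-! Put ε = 1 - β. Suppose that all critical points ζ of a monic P of degree n ≥ 3 satisfy |β - ζ| ≥
r with r ≥ 1 - 3ε/10. The sum of 1/(β - ζ) is twice the sum of 1/(β - z) over the other roots z, and
Re 1/(β - z) ≥ 1/2 - O(ε) because |z| ≤ 1. Hence every Re 1/(β - ζ) is almost 1, so Re ζ = O(ε) and
Im ζ = O(√ε) (`exists_criticalPoint_bound`).

P is recovered from the elementary symmetric functions of its critical points and from P(β) = 0.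
Since all roots lie in the disk, Re(w P'(w) conj P(w)) ≥ 0 on the unit circle. At an n-th root of
unity w, w P'(w)/n is near 1, so Re P(w) is bounded below up to a quadratic error. With A = Re Σ ζ,
Y = ½ Σ (Im ζ)² and u = 1 - Re w this reads, up to O(ε²), 0 ≤ ε + A u/(n-1) - 2Y u(2-u)/(n-2)
(`linear_constraint`). Divide by u and average over two roots of unity with weights for which E[u] ≤
(3n-2)/(2(n-1)) and E[1/u] ≤ 7/10 (`hasDualWeights`). The result is (Y - A)/(n-1) ≤ 7ε/10 + O(ε²).
Averaging |β - ζ|² gives r² ≤ 1 - 2ε + 2(Y - A)/(n-1) + O(ε²) ≤ 1 - 6ε/10 + O(ε²). This is linear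
programming duality: the weights are a dual feasible point.

Sharpness comes from an explicit quintic (`extremalQuintic`). Its critical points, rescaled by √ε,
tend to the roots of (5Z² + 1)(Z² + 1), and all four have squared distance at least 1 - 6ε/10 -
O(ε²) from β. -/

/-! ### Localization of the critical points -/

open Polynomial in
/-- At a simple root `b` of `P = (X - b) Q`, the critical points and the other roots balance. -/
theorem sum_inv_sub_derivative_roots {P Q : ℂ[X]} {b : ℂ} (h : P = (X - C b) * Q)
    (hQ : Q.eval b ≠ 0) :
    P.derivative.eval b = Q.eval b ∧
    (P.derivative.roots.map fun z => 1 / (b - z)).sum =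
      2 * (Q.roots.map fun z => 1 / (b - z)).sum := by
  have h1 : P.derivative.eval b = Q.eval b := by simp [h]
  refine ⟨h1, ?_⟩
  have h2 : P.derivative.derivative.eval b = 2 * Q.derivative.eval b := by
    simp [h]; ring
  rw [← (IsAlgClosed.splits P.derivative).eval_derivative_div_eval_of_ne_zero (h1 ▸ hQ),
    ← (IsAlgClosed.splits Q).eval_derivative_div_eval_of_ne_zero hQ, h2, h1, mul_div_assoc]

/-- With w = 1/(β - z), the condition |z| ≤ 1 becomes |βw - 1|² ≤ |w|², that is 2β Re w ≥ 1 - (1 -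
β²)|w|². For β = 1 this is the half-plane Re w ≥ 1/2. -/
theorem half_sub_le_re_one_div_sub {β K : ℝ} {z : ℂ} (hβ0 : 0 < β) (hβ1 : β ≤ 1) (hz : ‖z‖ ≤ 1)
    (hne : (β : ℂ) - z ≠ 0) (hK : ‖1 / ((β : ℂ) - z)‖ ≤ K) (hs : 2 * (1 - β) * K ^ 2 ≤ 1) :
    1 / 2 - (1 - β) * K ^ 2 ≤ (1 / ((β : ℂ) - z)).re := by
  set w := 1 / ((β : ℂ) - z) with hw
  have hd : 0 < Complex.normSq ((β : ℂ) - z) := Complex.normSq_pos.2 hne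
  have hw2 : Complex.normSq w = 1 / Complex.normSq ((β : ℂ) - z) := by
    rw [hw, map_div₀, map_one]
  have hwre : w.re = (β - z.re) * Complex.normSq w := by
    rw [hw2, hw, one_div, Complex.inv_re]; simp; ring
  have hwK : Complex.normSq w ≤ K ^ 2 := by
    rw [Complex.normSq_eq_norm_sq]
    exact pow_le_pow_left₀ (norm_nonneg _) hK 2
  have hz2 : z.re ^ 2 + z.im ^ 2 ≤ 1 := by
    have : Complex.normSq z ≤ 1 := by
      rw [Complex.normSq_eq_norm_sq]; exact pow_le_one₀ (norm_nonneg _) hz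
    rw [Complex.normSq_apply] at this; nlinarith
  have hmul : Complex.normSq w * ((β - z.re) ^ 2 + z.im ^ 2) = 1 := by
    have : Complex.normSq ((β : ℂ) - z) = (β - z.re) ^ 2 + z.im ^ 2 := by
      rw [Complex.normSq_apply]; simp; ring
    rw [hw2, ← this]; field_simp
  have hN : 0 ≤ Complex.normSq w := Complex.normSq_nonneg w
  have key : 1 - (1 - β ^ 2) * Complex.normSq w ≤ 2 * β * w.re := by
    rw [hwre]; nlinarith [mul_le_mul_of_nonneg_left hz2 hN]
  have h3 : (1 - β ^ 2) * Complex.normSq w ≤ 2 * (1 - β) * K ^ 2 := by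
    have : (1 - β ^ 2) ≤ 2 * (1 - β) := by nlinarith
    exact mul_le_mul this hwK hN (by linarith)
  -- The sign allows 2β Re w to be replaced by 2 Re w; this is what `hs` is for.
  have h4 : 0 ≤ w.re := by
    by_contra hc
    push Not at hc
    nlinarith
  nlinarith

theorem Multiset.sub_le_of_le_sum_map {α : Type*} {s : Multiset α} {f : α → ℝ} {a S : ℝ} {x : α}
    (hx : x ∈ s) (hf : ∀ y ∈ s, f y ≤ a) (hS : S ≤ (s.map f).sum) :
    S - ((s.card : ℝ) - 1) * a ≤ f x := by
  obtain ⟨t, rfl⟩ := Multiset.exists_cons_of_mem hx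
  have h := Multiset.sum_le_card_nsmul (t.map f) a (by
    intro y hy
    obtain ⟨u, hu, rfl⟩ := Multiset.mem_map.1 hy
    exact hf u (Multiset.mem_cons_of_mem hu))
  simp only [Multiset.map_cons, Multiset.sum_cons, Multiset.card_map, nsmul_eq_mul] at h hS
  simp only [Multiset.card_cons]
  push_cast
  linarith

theorem Complex.re_multiset_sum_map {α : Type*} (s : Multiset α) (f : α → ℂ) :
    (s.map f).sum.re = (s.map fun x => (f x).re).sum := by
  induction s using Multiset.induction with
  | empty => simp
  | cons a s ih => simp [ih]

theorem Multiset.prod_map_le_pow_card_of_nonneg {α : Type*} (s : Multiset α) (f : α → ℝ) {c : ℝ}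
    (h : ∀ a ∈ s, 0 ≤ f a ∧ f a ≤ c) : (s.map f).prod ≤ c ^ s.card := by
  induction s using Multiset.induction with
  | empty => simp
  | cons a s ih =>
    simp only [Multiset.map_cons, Multiset.prod_cons, Multiset.card_cons, pow_succ']
    have ha := h a (Multiset.mem_cons_self a s)
    have h0 : 0 ≤ (s.map f).prod := Multiset.prod_nonneg (by
      intro x hx
      obtain ⟨u, hu, rfl⟩ := Multiset.mem_map.1 hx
      exact (h u (Multiset.mem_cons_of_mem hu)).1)
    exact mul_le_mul ha.2 (ih fun b hb => h b (Multiset.mem_cons_of_mem hb)) h0 (ha.1.trans ha.2)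

theorem Multiset.pow_card_le_prod_map {α : Type*} (s : Multiset α) (f : α → ℝ) {c : ℝ}
    (hc : 0 ≤ c) (h : ∀ a ∈ s, c ≤ f a) : c ^ s.card ≤ (s.map f).prod := by
  induction s using Multiset.induction with
  | empty => simp
  | cons a s ih =>
    simp only [Multiset.map_cons, Multiset.prod_cons, Multiset.card_cons, pow_succ']
    have ha := h a (Multiset.mem_cons_self a s)
    exact mul_le_mul ha (ih fun b hb => h b (Multiset.mem_cons_of_mem hb)) (by positivity)
      (hc.trans ha)

open Polynomial in
theorem norm_eval_eq_prod_roots (P : ℂ[X]) (x : ℂ) :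
    ‖P.eval x‖ = ‖P.leadingCoeff‖ * (P.roots.map fun z => ‖x - z‖).prod := by
  rw [(IsAlgClosed.splits P).eval_eq_prod_roots, norm_mul]
  congr 1
  generalize P.roots = s
  induction s using Multiset.induction with
  | empty => simp
  | cons a s ih => simp [ih]

/-- If no critical point is within `1/2` of the root `b`, then all other roots are far from `b`. -/
theorem norm_one_div_sub_le {n : ℕ} (hn : 2 ≤ n) {P Q : Polynomial ℂ} {b : ℂ} (hb : ‖b‖ ≤ 1)
    (h : P = (Polynomial.X - Polynomial.C b) * Q) (hP : P.Monic) (hPn : P.natDegree = n)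
    (hQ : ∀ z ∈ Q.roots, ‖z‖ ≤ 1) (hr : ∀ ζ ∈ P.derivative.roots, 1 / 2 ≤ ‖b - ζ‖) :
    Q.eval b ≠ 0 ∧ ∀ z ∈ Q.roots, ‖1 / (b - z)‖ ≤ 4 ^ n := by
  have hQm : Q.Monic := (Polynomial.monic_X_sub_C b).of_mul_monic_left (h ▸ hP)
  have hQn : Q.natDegree + 1 = n := by
    rw [← hPn, h, (Polynomial.monic_X_sub_C b).natDegree_mul hQm, Polynomial.natDegree_X_sub_C]
    ring
  have hcQ : Q.roots.card = n - 1 := by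
    rw [← (IsAlgClosed.splits Q).natDegree_eq_card_roots]; omega
  have hcP : P.derivative.roots.card = n - 1 := by
    rw [← (IsAlgClosed.splits P.derivative).natDegree_eq_card_roots,
      Polynomial.natDegree_derivative, hPn]
  have hlc : ‖P.derivative.leadingCoeff‖ = n := by
    rw [Polynomial.leadingCoeff, Polynomial.natDegree_derivative, hPn, Polynomial.coeff_derivative]
    have : n - 1 + 1 = n := by omega
    rw [this, ← hPn, hP.coeff_natDegree, hPn]
    have : ((n - 1 : ℕ) : ℂ) + 1 = n := by rw [← Nat.cast_succ]; congr 1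
    rw [this]; simp
  have heq : P.derivative.eval b = Q.eval b := by simp [h]
  -- The number P'(b) = Q(b) is computed twice: from the critical points it is not small, while from
  -- the roots of Q it is at most |b - z| times factors of size at most 2.
  have hlow : (1 / 2 : ℝ) ^ (n - 1) ≤ ‖Q.eval b‖ := by
    rw [← heq, norm_eval_eq_prod_roots, hlc, ← hcP]
    have h1 := Multiset.pow_card_le_prod_map P.derivative.roots (fun z => ‖b - z‖)
      (by norm_num : (0 : ℝ) ≤ 1 / 2) hr
    have : (1 : ℝ) ≤ n := by exact_mod_cast (by omega : 1 ≤ n)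
    nlinarith [pow_pos (by norm_num : (0 : ℝ) < 1 / 2) P.derivative.roots.card]
  have hpos : 0 < ‖Q.eval b‖ := lt_of_lt_of_le (by positivity) hlow
  refine ⟨norm_pos_iff.1 hpos, fun z hz => ?_⟩
  obtain ⟨t, ht⟩ := Multiset.exists_cons_of_mem hz
  have hup : ‖Q.eval b‖ ≤ ‖b - z‖ * 2 ^ (n - 2) := by
    rw [norm_eval_eq_prod_roots, hQm.leadingCoeff, ht]
    have hct : t.card = n - 2 := by rw [ht, Multiset.card_cons] at hcQ; omega
    simp only [norm_one, one_mul, Multiset.map_cons, Multiset.prod_cons]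
    refine mul_le_mul_of_nonneg_left ?_ (norm_nonneg _)
    rw [← hct]
    refine Multiset.prod_map_le_pow_card_of_nonneg t _ fun y hy => ⟨norm_nonneg _, ?_⟩
    have := hQ y (ht ▸ Multiset.mem_cons_of_mem hy)
    linarith [norm_sub_le b y]
  have hbz : 0 < ‖b - z‖ := by
    by_contra hc
    have : ‖b - z‖ = 0 := le_antisymm (not_lt.1 hc) (norm_nonneg _)
    rw [this] at hup; linarith
  rw [norm_div, norm_one, div_le_iff₀ hbz]
  have h5 : (1 / 2 : ℝ) ^ (n - 1) ≤ ‖b - z‖ * 2 ^ (n - 2) := hlow.trans hup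
  have h6 : (1 : ℝ) ≤ ‖b - z‖ * (2 ^ (n - 2) * 2 ^ (n - 1)) := by
    have := mul_le_mul_of_nonneg_right h5 (by positivity : (0 : ℝ) ≤ 2 ^ (n - 1))
    rw [← mul_pow] at this
    norm_num at this
    linarith
  have h7 : (2 : ℝ) ^ (n - 2) * 2 ^ (n - 1) ≤ 4 ^ n := by
    rw [← pow_add, show (4 : ℝ) = 2 ^ 2 by norm_num, ← pow_mul]
    exact pow_le_pow_right₀ (by norm_num) (by omega)
  nlinarith

/-- Critical points at distance almost one from `β` with almost maximal real part of `1/(β-ζ)`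
are close to the origin. -/
theorem re_im_le_of_re_one_div {ε C β r : ℝ} {ζ : ℂ} (hε : 0 ≤ ε) (hC : 1 ≤ C)
    (hCε : C * ε ≤ 1 / 10) (hβ : β = 1 - ε) (hr : 1 - ε / 2 ≤ r) (hζ : r ≤ ‖(β : ℂ) - ζ‖)
    (hre : 1 - C * ε ≤ (1 / ((β : ℂ) - ζ)).re) :
    |ζ.re| ≤ 10 * C * ε ∧ ζ.im ^ 2 ≤ 20 * C * ε := by
  have hε1 : ε ≤ 1 / 10 := by nlinarith
  have hεC : ε ≤ C * ε := by nlinarith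
  set X := β - ζ.re with hX
  set D := X ^ 2 + ζ.im ^ 2 with hD
  have hnD : ‖(β : ℂ) - ζ‖ ^ 2 = D := by
    rw [← Complex.normSq_eq_norm_sq, Complex.normSq_apply]; simp [hD, hX]; ring
  have hDlow : 1 - ε ≤ D := by
    rw [← hnD]
    have : 1 - ε / 2 ≤ ‖(β : ℂ) - ζ‖ := hr.trans hζ
    nlinarith
  have hDpos : 0 < D := by linarith
  have hXD : (1 - C * ε) * D ≤ X := by
    have : (1 / ((β : ℂ) - ζ)).re = X / D := by
      rw [one_div, Complex.inv_re, Complex.normSq_eq_norm_sq, hnD]; simp [hX]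
    -- With X = Re(β - ζ) and D = |β - ζ|², the hypothesis is X ≥ (1 - c)D where c = Cε. Together
    -- with X² ≤ D and D ≥ 1 - ε this pins both X and D to 1 + O(c), and then (Im ζ)² = D - X² =
    -- O(c).
    rw [this, le_div_iff₀ hDpos] at hre
    exact hre
  set c := C * ε with hc
  have hc0 : 0 ≤ c := by positivity
  have hX0 : 0 < X := lt_of_lt_of_le (mul_pos (by linarith) hDpos) hXD
  have hD1 : (1 - c) ^ 2 * D ≤ 1 := by
    have h1 : ((1 - c) * D) ^ 2 ≤ X ^ 2 := pow_le_pow_left₀ (by nlinarith) hXD 2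
    have h2 : X ^ 2 ≤ D := by nlinarith [sq_nonneg ζ.im]
    have : D * ((1 - c) ^ 2 * D) ≤ D * 1 := by nlinarith
    exact le_of_mul_le_mul_left this hDpos
  have hDup : D ≤ 1 + 4 * c := by
    have : 1 ≤ (1 - c) ^ 2 * (1 + 4 * c) := by
      nlinarith [mul_nonneg hc0 (sub_nonneg.2 hCε), pow_nonneg hc0 3]
    by_contra hcon
    push Not at hcon
    have : (1 - c) ^ 2 * (1 + 4 * c) < (1 - c) ^ 2 * D :=
      mul_lt_mul_of_pos_left hcon (by nlinarith)
    linarith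
  have hXlow : 1 - 2 * c ≤ X := by
    have : (1 - c) * (1 - c) ≤ (1 - c) * D :=
      mul_le_mul_of_nonneg_left (by linarith) (by linarith)
    nlinarith
  have hXup : X ≤ 1 + 4 * c := by
    have h2 : X ^ 2 ≤ (1 + 4 * c) ^ 2 := by nlinarith [sq_nonneg ζ.im, sq_nonneg c]
    exact (abs_le_of_sq_le_sq' h2 (by linarith)).2
  constructor
  · rw [show 10 * C * ε = 10 * c by rw [hc]; ring, abs_le]
    constructor <;> linarith
  · rw [show 20 * C * ε = 20 * c by rw [hc]; ring]
    have : (1 - 2 * c) ^ 2 ≤ X ^ 2 := pow_le_pow_left₀ (by linarith) hXlow 2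
    nlinarith

/-- For `β` near `1`, if all critical points have distance at least `r` (close to `1`) from the
root `β`, then they lie within `O(1 - β)` of the imaginary axis and `O(√(1 - β))` of the origin. -/
theorem exists_criticalPoint_bound (n : ℕ) (hn : 2 ≤ n) : ∃ C : ℝ, 0 < C ∧ ∃ δ : ℝ, 0 < δ ∧ δ ≤ 1 ∧
    ∀ (β ε r : ℝ) (P : Polynomial ℂ), 0 ≤ ε → ε ≤ δ → β = 1 - ε → 1 - ε / 2 ≤ r → P.Monic →
      P.natDegree = n → (∀ z : ℂ, P.IsRoot z → ‖z‖ ≤ 1) → P.IsRoot β →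
      (∀ ζ ∈ P.derivative.roots, r ≤ ‖(β : ℂ) - ζ‖) →
      ∀ ζ ∈ P.derivative.roots, |ζ.re| ≤ C * ε ∧ ζ.im ^ 2 ≤ C * ε := by
  set K : ℝ := 4 ^ n with hK
  have hK1 : 1 ≤ K := one_le_pow₀ (by norm_num)
  have hn1 : (2 : ℝ) ≤ n := by exact_mod_cast hn
  -- The n - 1 real parts Re 1/(β - ζ) sum to at least (n-1)(1 - 2εK²) and each is at most 1 + ε.
  -- Subtracting n - 2 of them leaves at least 1 - n(2K² + 1)ε for the remaining one.
  set C : ℝ := n * (2 * K ^ 2 + 1) with hC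
  have hC1 : 1 ≤ C := by rw [hC]; nlinarith
  refine ⟨20 * C, by positivity, 1 / (10 * C), by positivity, ?_, ?_⟩
  · rw [div_le_one (by positivity)]; linarith
  intro β ε r P hε hεδ hβ hr hP hPn hroots hroot hcrit
  have hCε : C * ε ≤ 1 / 10 := by
    rw [le_div_iff₀ (by positivity)] at hεδ; linarith
  have hKC : 2 * K ^ 2 ≤ C := by rw [hC]; nlinarith [sq_nonneg K]
  have hε1 : ε ≤ 1 / 10 := by nlinarith
  obtain ⟨Q, hQ⟩ := Polynomial.dvd_iff_isRoot.2 hroot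
  have hP0 : P ≠ 0 := hP.ne_zero
  have hQ0 : Q ≠ 0 := by rintro rfl; simp at hQ; exact hP0 hQ
  have hQr : ∀ z ∈ Q.roots, ‖z‖ ≤ 1 := by
    intro z hz
    apply hroots
    rw [Polynomial.mem_roots hQ0] at hz
    rw [hQ, Polynomial.IsRoot.def, Polynomial.eval_mul, hz.eq_zero, mul_zero]
  have hb : ‖(β : ℂ)‖ ≤ 1 := hroots _ hroot
  obtain ⟨hQb, hw⟩ := norm_one_div_sub_le hn hb hQ hP hPn hQr
    (fun ζ hζ => le_trans (by linarith) (hcrit ζ hζ))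
  obtain ⟨-, hsum⟩ := sum_inv_sub_derivative_roots hQ hQb
  have hcP : P.derivative.roots.card = n - 1 := by
    rw [← (IsAlgClosed.splits P.derivative).natDegree_eq_card_roots,
      Polynomial.natDegree_derivative, hPn]
  have hcQ : Q.roots.card = n - 1 := by
    have h2 := hQ ▸ hPn
    rw [Polynomial.natDegree_mul (Polynomial.X_sub_C_ne_zero _) hQ0,
      Polynomial.natDegree_X_sub_C] at h2
    rw [← (IsAlgClosed.splits Q).natDegree_eq_card_roots]; omega
  have hn1' : ((n - 1 : ℕ) : ℝ) = (n : ℝ) - 1 := by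
    rw [Nat.cast_sub (by omega)]; simp
  have hlow : ((n : ℝ) - 1) * (1 / 2 - ε * K ^ 2) ≤
      (Q.roots.map fun z => (1 / ((β : ℂ) - z)).re).sum := by
    have h := Multiset.card_nsmul_le_sum (s := Q.roots.map fun z => (1 / ((β : ℂ) - z)).re)
      (a := 1 / 2 - ε * K ^ 2) (by
        intro x hx
        obtain ⟨z, hz, rfl⟩ := Multiset.mem_map.1 hx
        have hne : (β : ℂ) - z ≠ 0 := by
          intro h0
          rw [← sub_eq_zero.1 h0] at hz
          exact hQb ((Polynomial.mem_roots hQ0).1 hz)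
        have := half_sub_le_re_one_div_sub (by linarith) (by linarith) (hQr z hz) hne (hw z hz)
          (by rw [hβ]; nlinarith)
        rwa [show 1 - β = ε by rw [hβ]; ring] at this)
    rw [Multiset.card_map, hcQ, nsmul_eq_mul, hn1'] at h
    exact h
  have hS : ((n : ℝ) - 1) * (1 - 2 * ε * K ^ 2) ≤
      (P.derivative.roots.map fun z => (1 / ((β : ℂ) - z)).re).sum := by
    rw [← Complex.re_multiset_sum_map, hsum]
    have : (2 * (Q.roots.map fun z => 1 / ((β : ℂ) - z)).sum).re =
        2 * (Q.roots.map fun z => (1 / ((β : ℂ) - z)).re).sum := by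
      rw [← Complex.re_multiset_sum_map]; simp
    rw [this]; linarith
  intro ζ hζ
  have hup : ∀ z ∈ P.derivative.roots, (1 / ((β : ℂ) - z)).re ≤ 1 + ε := by
    intro z hz
    refine (Complex.re_le_norm _).trans ?_
    have h1 : 1 - ε / 2 ≤ ‖(β : ℂ) - z‖ := hr.trans (hcrit z hz)
    rw [norm_div, norm_one, div_le_iff₀ (by linarith)]
    nlinarith
  have h1 := Multiset.sub_le_of_le_sum_map hζ hup hS
  rw [hcP, hn1'] at h1
  have h2 : 1 - C * ε ≤ (1 / ((β : ℂ) - ζ)).re := by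
    refine le_trans ?_ h1
    rw [hC]; nlinarith [mul_nonneg hε (sq_nonneg K)]
  obtain ⟨h3, h4⟩ := re_im_le_of_re_one_div hε hC1 hCε hβ hr (hcrit ζ hζ) h2
  refine ⟨h3.trans ?_, h4⟩
  nlinarith

/-! ### Dual weights on roots of unity -/

/-- Nontrivial `n`-th roots of unity `ω₁, ω₂` and weights `p, 1 - p`. -/
def HasDualWeights (n : ℕ) : Prop :=
  ∃ (ω₁ ω₂ : ℂ) (p : ℝ), ω₁ ^ n = 1 ∧ ω₂ ^ n = 1 ∧ 0 ≤ p ∧ p ≤ 1 ∧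
    0 < 1 - ω₁.re ∧ 0 < 1 - ω₂.re ∧
    p * (1 - ω₁.re) + (1 - p) * (1 - ω₂.re) ≤ (3 * n - 2) / (2 * (n - 1)) ∧
    p / (1 - ω₁.re) + (1 - p) / (1 - ω₂.re) ≤ 7 / 10

theorem exists_root_of_unity_re (n k : ℕ) (hn : n ≠ 0) :
    ∃ ω : ℂ, ω ^ n = 1 ∧ ω.re = Real.cos (2 * Real.pi * k / n) := by
  refine ⟨Complex.exp ((2 * Real.pi * k / n : ℝ) * Complex.I), ?_, Complex.exp_ofReal_mul_I_re _⟩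
  rw [← Complex.exp_nat_mul]
  have : (n : ℂ) * ((2 * Real.pi * k / n : ℝ) * Complex.I) = k * (2 * Real.pi * Complex.I) := by
    have : (n : ℂ) ≠ 0 := by exact_mod_cast hn
    push_cast; field_simp
  rw [this, Complex.exp_nat_mul_two_pi_mul_I]

theorem hasDualWeights_of_cos {n : ℕ} (hn : n ≠ 0) (k l : ℕ) (p : ℝ) {x y : ℝ}
    (hx : Real.cos (2 * Real.pi * k / n) = 1 - x) (hy : Real.cos (2 * Real.pi * l / n) = 1 - y)
    (hx0 : 0 < x) (hy0 : 0 < y) (hp0 : 0 ≤ p) (hp1 : p ≤ 1)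
    (h1 : p * x + (1 - p) * y ≤ (3 * n - 2) / (2 * (n - 1))) (h2 : p / x + (1 - p) / y ≤ 7 / 10) :
    HasDualWeights n := by
  obtain ⟨ω₁, h3, h4⟩ := exists_root_of_unity_re n k hn
  obtain ⟨ω₂, h5, h6⟩ := exists_root_of_unity_re n l hn
  refine ⟨ω₁, ω₂, p, h3, h5, hp0, hp1, ?_⟩
  rw [h4, h6, hx, hy]
  simp only [sub_sub_cancel]
  exact ⟨hx0, hy0, h1, h2⟩

theorem cos_two_pi_div_three : Real.cos (2 * Real.pi / 3) = -1 / 2 := by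
  rw [show 2 * Real.pi / 3 = Real.pi - Real.pi / 3 by ring, Real.cos_pi_sub, Real.cos_pi_div_three]
  ring

theorem hasDualWeights_three : HasDualWeights 3 := by
  refine hasDualWeights_of_cos (by norm_num) 1 1 1 (x := 3 / 2) (y := 3 / 2) ?_ ?_ ?_ ?_ ?_ ?_ ?_ ?_
  iterate 2
    rw [← show 2 * Real.pi / 3 = 2 * Real.pi * (1 : ℕ) / (3 : ℕ) by push_cast; ring,
      cos_two_pi_div_three]; norm_num
  all_goals norm_num

theorem hasDualWeights_four : HasDualWeights 4 := by
  refine hasDualWeights_of_cos (by norm_num) 1 2 (1 / 3) (x := 1) (y := 2) ?_ ?_ ?_ ?_ ?_ ?_ ?_ ?_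
  · rw [← show Real.pi / 2 = 2 * Real.pi * (1 : ℕ) / (4 : ℕ) by push_cast; ring]; norm_num
  · rw [← show Real.pi = 2 * Real.pi * (2 : ℕ) / (4 : ℕ) by push_cast; ring]; norm_num
  all_goals norm_num

/-- Both inequalities hold with equality here: E[u] = 13/8 and E[1/u] = 7/10. This is the degree for
which the final bound is attained. -/
theorem hasDualWeights_five : HasDualWeights 5 := by
  have h5 : √5 ^ 2 = (5 : ℝ) := Real.sq_sqrt (by norm_num)
  have hlo : (2 : ℝ) < √5 := by rw [Real.lt_sqrt] <;> norm_num
  have hhi : √5 < (3 : ℝ) := by rw [Real.sqrt_lt'] <;> norm_num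
  have hp : √5 * (3 * √5 / 20) = (3 / 4 : ℝ) := by nlinarith
  refine hasDualWeights_of_cos (by norm_num) 1 2 (1 / 2 - 3 * √5 / 20) (x := (5 - √5) / 4)
    (y := (5 + √5) / 4) ?_ ?_ ?_ ?_ ?_ ?_ ?_ ?_
  · rw [← show 2 * (Real.pi / 5) = 2 * Real.pi * (1 : ℕ) / (5 : ℕ) by push_cast; ring,
      Real.cos_two_mul, Real.cos_pi_div_five]
    nlinarith
  · rw [← show Real.pi - Real.pi / 5 = 2 * Real.pi * (2 : ℕ) / (5 : ℕ) by push_cast; ring,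
      Real.cos_pi_sub, Real.cos_pi_div_five]
    ring
  · linarith
  · linarith
  · linarith
  · linarith
  · norm_num; nlinarith
  · have ha : (5 - √5) / 4 ≠ (0 : ℝ) := by linarith
    have hb : (5 + √5) / 4 ≠ (0 : ℝ) := by linarith
    have hab : (5 - √5) / 4 * ((5 + √5) / 4) = (5 / 4 : ℝ) := by nlinarith
    rw [div_add_div _ _ ha hb, hab]
    apply le_of_eq
    rw [div_eq_iff (by norm_num)]
    nlinarith

theorem hasDualWeights_six : HasDualWeights 6 := by
  refine hasDualWeights_of_cos (by norm_num) 2 2 1 (x := 3 / 2) (y := 3 / 2) ?_ ?_ ?_ ?_ ?_ ?_ ?_ ?_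
  iterate 2
    rw [← show 2 * Real.pi / 3 = 2 * Real.pi * (2 : ℕ) / (6 : ℕ) by push_cast; ring,
      cos_two_pi_div_three]; norm_num
  all_goals norm_num

theorem hasDualWeights_seven : HasDualWeights 7 := by
  have hpi1 := Real.pi_gt_d2
  have hpi2 := Real.pi_lt_d2
  have hs1 : 1.22 ≤ 1 + Real.sin (Real.pi / 14) := by
    have h := Real.sin_gt_sub_cube (x := Real.pi / 14) (by positivity)
    have : (Real.pi / 14) ^ 3 ≤ 0.225 ^ 3 := pow_le_pow_left₀ (by positivity) (by linarith) 3
    linarith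
  have hs2 : 1 + Real.sin (Real.pi / 14) ≤ 1.2251 := by
    have := Real.sin_le (x := Real.pi / 14) (by positivity)
    linarith
  have hc1 : 1.898 ≤ 1 + Real.cos (Real.pi / 7) := by
    have h := Real.one_sub_sq_div_two_le_cos (x := Real.pi / 7)
    have : (Real.pi / 7) ^ 2 ≤ 0.45 ^ 2 := pow_le_pow_left₀ (by positivity) (by linarith) 2
    linarith
  have hc2 : 1 + Real.cos (Real.pi / 7) ≤ 1.9592 := by
    have h := Real.cos_le_one_sub_mul_cos_sq (x := Real.pi / 7) (by
      rw [abs_of_nonneg (by positivity)]; linarith)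
    have h2 : 2 / Real.pi ^ 2 * (Real.pi / 7) ^ 2 = 2 / 49 := by field_simp; norm_num
    rw [h2] at h
    linarith
  refine hasDualWeights_of_cos (by norm_num) 2 3 (11 / 20) (x := 1 + Real.sin (Real.pi / 14))
    (y := 1 + Real.cos (Real.pi / 7)) ?_ ?_ ?_ ?_ ?_ ?_ ?_ ?_
  · rw [← show Real.pi / 14 + Real.pi / 2 = 2 * Real.pi * (2 : ℕ) / (7 : ℕ) by push_cast; ring,
      Real.cos_add_pi_div_two]; ring
  · rw [← show Real.pi - Real.pi / 7 = 2 * Real.pi * (3 : ℕ) / (7 : ℕ) by push_cast; ring,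
      Real.cos_pi_sub]; ring
  · linarith
  · linarith
  · norm_num
  · norm_num
  · norm_num; linarith
  · have h1 : 11 / 20 / (1 + Real.sin (Real.pi / 14)) ≤ 11 / 20 / 1.22 :=
      div_le_div_of_nonneg_left (by norm_num) (by norm_num) hs1
    have h2 : (1 - 11 / 20) / (1 + Real.cos (Real.pi / 7)) ≤ (1 - 11 / 20) / 1.898 :=
      div_le_div_of_nonneg_left (by norm_num) (by norm_num) hc1
    norm_num at h1 h2 ⊢
    linarith

theorem hasDualWeights_eight : HasDualWeights 8 := by
  have h5 : √2 ^ 2 = (2 : ℝ) := Real.sq_sqrt (by norm_num)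
  have hlo : (1.41 : ℝ) < √2 := by rw [Real.lt_sqrt] <;> norm_num
  have hhi : √2 < (1.42 : ℝ) := by rw [Real.sqrt_lt'] <;> norm_num
  refine hasDualWeights_of_cos (by norm_num) 2 3 (1 / 5) (x := 1)
    (y := 1 + √2 / 2) ?_ ?_ ?_ ?_ ?_ ?_ ?_ ?_
  · rw [← show Real.pi / 2 = 2 * Real.pi * (2 : ℕ) / (8 : ℕ) by push_cast; ring]; norm_num
  · rw [← show Real.pi - Real.pi / 4 = 2 * Real.pi * (3 : ℕ) / (8 : ℕ) by push_cast; ring,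
      Real.cos_pi_sub, Real.cos_pi_div_four]
    ring
  · norm_num
  · linarith
  · norm_num
  · norm_num
  · norm_num; linarith
  · have h2 : (1 - 1 / 5) / (1 + √2 / 2) ≤ (1 - 1 / 5) / 1.705 :=
      div_le_div_of_nonneg_left (by norm_num) (by norm_num) (by linarith)
    norm_num at h2 ⊢
    linarith

/-- Let m be the prescribed mean. Two neighbouring roots of unity have values a ≤ m < b of 1 - Re,
and the weights make the mean exactly m. Then E[1/u] = (a + b - m)/(ab), and m(a + b - m) = ab + (m
- a)(b - m), where the last product is at most h²/4 because cosine is 1-Lipschitz. Since m > 3/2,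
the factor 7m/10 - 1 exceeds 1/20, which pays for this term once h is small. -/
theorem hasDualWeights_of_nine_le {n : ℕ} (hn : 9 ≤ n) : HasDualWeights n := by
  have hn9 : (9 : ℝ) ≤ n := by exact_mod_cast hn
  have hpi := Real.pi_pos
  have hpi2 := Real.pi_lt_d2
  set m : ℝ := (3 * n - 2) / (2 * (n - 1)) with hm
  set h : ℝ := 2 * Real.pi / n with hh
  have hh0 : 0 < h := by positivity
  have hmn : m = 3 / 2 + 1 / (2 * (n - 1)) := by
    have : (n : ℝ) - 1 ≠ 0 := by linarith
    rw [hm]; field_simp; ring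
  have hinv : 0 < 1 / (2 * ((n : ℝ) - 1)) := by apply one_div_pos.2; linarith
  have hinv2 : 1 / (2 * ((n : ℝ) - 1)) ≤ 1 / 16 := by
    apply one_div_le_one_div_of_le <;> linarith
  have hhn : h * n = 2 * Real.pi := by rw [hh]; field_simp
  have hh7 : h ≤ 0.7 := by
    rw [hh, div_le_iff₀ (by linarith)]; nlinarith
  have hgap : h ^ 2 ≤ 4 * (7 / 10 * m - 1) * (m * (m - h)) := by
    -- The right side equals h/(2(2π - h)), convex in h; an affine minorant on (0, 0.7] reduces
    -- `hgap` to a polynomial inequality in h alone.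
    have ht : 0.1 * h - 0.0078 ≤ 1 / (2 * ((n : ℝ) - 1)) := by
      rw [le_div_iff₀ (by linarith)]
      have h1 : h * (n - 1) ≤ 6.3 - h := by linarith
      have h2 : (0.2 * h - 0.0156) * (n - 1) * h ≤ h := by
        rcases le_total (0.2 * h - 0.0156) 0 with h3 | h3
        · have : (0.2 * h - 0.0156) * ((n - 1) * h) ≤ 0 :=
            mul_nonpos_of_nonpos_of_nonneg h3 (mul_nonneg (by linarith) hh0.le)
          linarith
        · have : (0.2 * h - 0.0156) * (h * (n - 1)) ≤ (0.2 * h - 0.0156) * (6.3 - h) :=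
            mul_le_mul_of_nonneg_left h1 h3
          nlinarith [sq_nonneg (h - 0.7)]
      have h4 : (0.2 * h - 0.0156) * (n - 1) ≤ 1 := by
        by_contra hc
        push Not at hc
        nlinarith
      linarith
    set t : ℝ := 0.1 * h - 0.0078 with htt
    have hmt : 1.5 + t ≤ m := by linarith
    have e1 : 0.05 + 0.7 * t ≤ 7 / 10 * m - 1 := by linarith
    have e2 : (1.5 + t) * (1.5 + t - h) ≤ m * (m - h) :=
      mul_le_mul hmt (by linarith) (by linarith) (by linarith)
    have e3 : (0.05 + 0.7 * t) * ((1.5 + t) * (1.5 + t - h)) ≤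
        (7 / 10 * m - 1) * (m * (m - h)) :=
      mul_le_mul e1 e2 (mul_nonneg (by linarith) (by linarith)) (by linarith)
    have e4 : h ^ 2 ≤ 4 * ((0.05 + 0.7 * t) * ((1.5 + t) * (1.5 + t - h))) := by
      rw [htt]
      nlinarith [mul_nonneg hh0.le (sub_nonneg.2 hh7),
        mul_nonneg (mul_nonneg hh0.le (sub_nonneg.2 hh7)) hh0.le]
    linarith
  have hm1 : m < 1.6 := by linarith
  set θ := Real.arccos (1 - m) with hθ
  have hcosθ : Real.cos θ = 1 - m := Real.cos_arccos (by linarith) (by linarith)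
  have hθ0 : 0 ≤ θ := Real.arccos_nonneg _
  -- The next multiple of h after θ must not jump over the whole arc (θ, 2π - θ), on which 1 - cos
  -- exceeds m.
  have hθ1 : θ + h < 2 * Real.pi - θ := by
    have : θ ≤ 2.4 := by
      by_contra hc
      push Not at hc
      have h1 : Real.cos θ < Real.cos (3 * Real.pi / 4) := by
        apply Real.cos_lt_cos_of_nonneg_of_le_pi _ (Real.arccos_le_pi _)
        · linarith
        · positivity
      rw [show 3 * Real.pi / 4 = Real.pi - Real.pi / 4 by ring, Real.cos_pi_sub,
        Real.cos_pi_div_four, hcosθ] at h1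
      have : (1.4 : ℝ) < √2 := by rw [Real.lt_sqrt] <;> norm_num
      linarith
    linarith [Real.pi_gt_d2]
  set k := ⌊θ / h⌋₊ with hk
  have hk1 : h * k ≤ θ := by
    have := Nat.floor_le (div_nonneg hθ0 hh0.le)
    rw [le_div_iff₀ hh0] at this; linarith
  have hk2 : θ < h * (k + 1) := by
    have := Nat.lt_floor_add_one (θ / h)
    rw [div_lt_iff₀ hh0] at this; linarith
  set a := 1 - Real.cos (h * k) with ha
  set b := 1 - Real.cos (h * (k + 1)) with hb
  have ham : a ≤ m := by
    have : Real.cos θ ≤ Real.cos (h * k) :=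
      Real.cos_le_cos_of_nonneg_of_le_pi (by positivity) (Real.arccos_le_pi _) hk1
    linarith
  have hbm : m < b := by
    have : Real.cos (h * (k + 1)) < Real.cos θ := by
      rcases le_total (h * (k + 1)) Real.pi with hc | hc
      · exact Real.cos_lt_cos_of_nonneg_of_le_pi hθ0 hc hk2
      · have h1 : Real.cos (h * (k + 1)) = Real.cos (2 * Real.pi - h * (k + 1)) := by
          rw [Real.cos_two_pi_sub]
        rw [h1]
        apply Real.cos_lt_cos_of_nonneg_of_le_pi hθ0 (by linarith)
        linarith
    linarith
  have hba : b - a ≤ h := by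
    have := Real.lipschitzWith_cos.dist_le_mul (h * k) (h * (k + 1))
    rw [Real.dist_eq, Real.dist_eq, show h * k - h * (k + 1) = -h by ring, abs_neg,
      abs_of_pos hh0, NNReal.coe_one, one_mul] at this
    have := le_abs_self (Real.cos (h * k) - Real.cos (h * (k + 1)))
    linarith
  have ha0 : 0 < a := by linarith
  have hb0 : 0 < b := by linarith
  have hab : 0 < b - a := by linarith
  refine hasDualWeights_of_cos (by omega) k (k + 1) ((b - m) / (b - a)) (x := a) (y := b)
    ?_ ?_ ha0 hb0 ?_ ?_ ?_ ?_
  · rw [ha, hh, sub_sub_cancel]; congr 1; ring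
  · rw [hb, hh, sub_sub_cancel]; congr 1; push_cast; ring
  · apply div_nonneg <;> linarith
  · rw [div_le_one hab]; linarith
  · rw [← hm]; apply le_of_eq; field_simp; ring
  · have : (b - m) / (b - a) / a + (1 - (b - m) / (b - a)) / b = (a + b - m) / (a * b) := by
      field_simp; ring
    rw [this, div_le_iff₀ (by positivity)]
    have h1 : 4 * ((m - a) * (b - m)) ≤ h ^ 2 := by
      have e1 : (b - a) ^ 2 ≤ h ^ 2 := pow_le_pow_left₀ hab.le hba 2
      have e2 : 4 * ((m - a) * (b - m)) = (b - a) ^ 2 - ((m - a) - (b - m)) ^ 2 := by ring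
      linarith [sq_nonneg ((m - a) - (b - m))]
    have h2 : m * (m - h) ≤ a * b := by
      rw [mul_comm a b]
      exact mul_le_mul hbm.le (by linarith) (by linarith) hb0.le
    have h3 : (7 / 10 * m - 1) * (m * (m - h)) ≤ (7 / 10 * m - 1) * (a * b) :=
      mul_le_mul_of_nonneg_left h2 (by linarith)
    have h4 : m * (a + b - m) ≤ m * (7 / 10 * (a * b)) := by
      have e1 : m * (a + b - m) = a * b + (m - a) * (b - m) := by ring
      have e2 : m * (7 / 10 * (a * b)) = a * b + (7 / 10 * m - 1) * (a * b) := by ring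
      rw [e1, e2]
      linarith
    exact le_of_mul_le_mul_left h4 (by linarith)

theorem hasDualWeights {n : ℕ} (hn : 3 ≤ n) : HasDualWeights n := by
  rcases le_or_gt 9 n with h | h
  · exact hasDualWeights_of_nine_le h
  · interval_cases n
    · exact hasDualWeights_three
    · exact hasDualWeights_four
    · exact hasDualWeights_five
    · exact hasDualWeights_six
    · exact hasDualWeights_seven
    · exact hasDualWeights_eight

/-! ### Elementary symmetric functions of the critical points -/

section Esymm

theorem Multiset.esymm_cons_succ {R : Type*} [CommSemiring R] (a : R) (s : Multiset R) (k : ℕ) :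
    (a ::ₘ s).esymm (k + 1) = s.esymm (k + 1) + a * s.esymm k := by
  simp only [Multiset.esymm, Multiset.powersetCard_cons, Multiset.map_add, Multiset.sum_add,
    Multiset.map_map, Function.comp_def, Multiset.prod_cons, Multiset.sum_map_mul_left]

theorem Multiset.esymm_zero_right {R : Type*} [CommSemiring R] (s : Multiset R) :
    s.esymm 0 = 1 := by
  simp [Multiset.esymm]

theorem Multiset.esymm_empty_succ {R : Type*} [CommSemiring R] (k : ℕ) :
    (0 : Multiset R).esymm (k + 1) = 0 := by
  simp [Multiset.esymm, Multiset.powersetCard_zero_right]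

theorem Multiset.esymm_one_eq_sum {R : Type*} [CommSemiring R] (s : Multiset R) :
    s.esymm 1 = s.sum := by
  induction s using Multiset.induction with
  | empty => simp [Multiset.esymm_empty_succ]
  | cons a s ih => rw [Multiset.esymm_cons_succ, ih, Multiset.esymm_zero_right]; simp [add_comm]

theorem Multiset.two_mul_esymm_two {R : Type*} [CommRing R] (s : Multiset R) :
    2 * s.esymm 2 = s.sum ^ 2 - (s.map (· ^ 2)).sum := by
  induction s using Multiset.induction with
  | empty => simp [Multiset.esymm_empty_succ]
  | cons a s ih =>
    rw [Multiset.esymm_cons_succ, mul_add, ih, Multiset.esymm_one_eq_sum]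
    simp; ring

theorem Multiset.six_mul_esymm_three {R : Type*} [CommRing R] (s : Multiset R) :
    6 * s.esymm 3 = s.sum ^ 3 - 3 * s.sum * (s.map (· ^ 2)).sum + 2 * (s.map (· ^ 3)).sum := by
  induction s using Multiset.induction with
  | empty => simp [Multiset.esymm_empty_succ]
  | cons a s ih =>
    rw [Multiset.esymm_cons_succ, mul_add, ih]
    have := Multiset.two_mul_esymm_two s
    simp only [Multiset.sum_cons, Multiset.map_cons]
    linear_combination 3 * a * this

theorem Multiset.norm_esymm_le (s : Multiset ℂ) {B : ℝ} (hB : ∀ z ∈ s, ‖z‖ ≤ B)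
    (hB0 : 0 ≤ B) (k : ℕ) : ‖s.esymm k‖ ≤ 2 ^ s.card * B ^ k := by
  induction s using Multiset.induction generalizing k with
  | empty =>
    cases k with
    | zero => simp [Multiset.esymm_zero_right]
    | succ k => simp [Multiset.esymm_empty_succ]; positivity
  | cons a s ih =>
    have ih' := ih fun z hz => hB z (Multiset.mem_cons_of_mem hz)
    cases k with
    | zero => simpa [Multiset.esymm_zero_right] using one_le_pow₀ (by norm_num)
    | succ k =>
      rw [Multiset.esymm_cons_succ, Multiset.card_cons]
      refine (norm_add_le _ _).trans ?_
      rw [norm_mul]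
      have := mul_le_mul (hB a (Multiset.mem_cons_self a s)) (ih' k) (norm_nonneg _) hB0
      have h2 := ih' (k + 1)
      calc _ ≤ 2 ^ s.card * B ^ (k + 1) + B * (2 ^ s.card * B ^ k) := add_le_add h2 this
        _ = _ := by ring

theorem Multiset.abs_sum_map_le {α : Type*} (s : Multiset α) (f : α → ℝ) {c : ℝ}
    (h : ∀ a ∈ s, |f a| ≤ c) : |(s.map f).sum| ≤ s.card * c := by
  induction s using Multiset.induction with
  | empty => simp
  | cons a s ih =>
    simp only [Multiset.map_cons, Multiset.sum_cons, Multiset.card_cons]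
    have h1 := h a (Multiset.mem_cons_self a s)
    have h2 := ih fun b hb => h b (Multiset.mem_cons_of_mem hb)
    push_cast
    calc _ ≤ |f a| + |(s.map f).sum| := abs_add_le _ _
      _ ≤ _ := by linarith

end Esymm

open Polynomial in
theorem coeff_derivative_eq_esymm {n : ℕ} {P : ℂ[X]} (hP : P.Monic) (hPn : P.natDegree = n)
    {k : ℕ} (hk : k < n) :
    P.derivative.coeff (n - 1 - k) = n * ((-1) ^ k * P.derivative.roots.esymm k) := by
  have hd : P.derivative.natDegree = n - 1 := by rw [natDegree_derivative, hPn]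
  have hlc : P.derivative.leadingCoeff = n := by
    rw [leadingCoeff, hd, coeff_derivative]
    have : n - 1 + 1 = n := by omega
    rw [this, ← hPn, hP.coeff_natDegree, hPn, one_mul, ← Nat.cast_succ]
    congr 1
  rw [coeff_eq_esymm_roots_of_card (IsAlgClosed.splits _).natDegree_eq_card_roots.symm
    (by rw [hd]; omega), hlc, hd, Nat.sub_sub_self (by omega), mul_assoc]

-- Vieta's formulas for P', integrated term by term; the constant of integration is fixed by P(b) =
-- 0.
open Polynomial in
theorem eval_eq_sum_esymm {n : ℕ} {P : ℂ[X]} (hP : P.Monic) (hPn : P.natDegree = n)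
    {b : ℂ} (hb : P.IsRoot b) (w : ℂ) :
    P.eval w = ∑ k ∈ Finset.range n, ((n / (n - k) : ℝ) : ℂ) *
      ((-1) ^ k * P.derivative.roots.esymm k * (w ^ (n - k) - b ^ (n - k))) := by
  have h1 : ∀ x, P.eval x = P.coeff 0 + ∑ j ∈ Finset.range n, P.coeff (j + 1) * x ^ (j + 1) := by
    intro x
    rw [eval_eq_sum_range, hPn, Finset.sum_range_succ']
    simp [add_comm]
  have h2 : P.eval w = ∑ j ∈ Finset.range n, P.coeff (j + 1) * (w ^ (j + 1) - b ^ (j + 1)) := by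
    have := h1 b
    rw [hb.eq_zero] at this
    rw [← sub_zero (P.eval w), this, h1 w, add_sub_add_left_eq_sub, ← Finset.sum_sub_distrib]
    exact Finset.sum_congr rfl fun j _ => by ring
  rw [h2, ← Finset.sum_range_reflect]
  refine Finset.sum_congr rfl fun k hk => ?_
  rw [Finset.mem_range] at hk
  have h3 : n - 1 - k + 1 = n - k := by omega
  have h4 := coeff_derivative_eq_esymm hP hPn hk
  rw [coeff_derivative, h3] at h4
  have h5 : ((n - 1 - k : ℕ) : ℂ) + 1 = n - k := by
    rw [← Nat.cast_succ, Nat.succ_eq_add_one, h3, Nat.cast_sub hk.le]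
  rw [h5] at h4
  have h6 : (n : ℂ) - k ≠ 0 := by
    rw [sub_ne_zero]; exact_mod_cast hk.ne'
  rw [h3, (eq_div_iff h6).2 h4]
  push_cast
  ring

open Polynomial in
theorem mul_eval_derivative_eq_sum_esymm {n : ℕ} (hn : 1 ≤ n) {P : ℂ[X]} (hP : P.Monic)
    (hPn : P.natDegree = n) (w : ℂ) :
    w * P.derivative.eval w = n * ∑ k ∈ Finset.range n,
      (-1) ^ k * P.derivative.roots.esymm k * w ^ (n - k) := by
  have hd : P.derivative.natDegree = n - 1 := by rw [natDegree_derivative, hPn]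
  have : n - 1 + 1 = n := by omega
  rw [eval_eq_sum_range, hd, this, ← Finset.sum_range_reflect, Finset.mul_sum, Finset.mul_sum]
  refine Finset.sum_congr rfl fun k hk => ?_
  rw [Finset.mem_range] at hk
  have h3 : n - k = n - 1 - k + 1 := by omega
  rw [coeff_derivative_eq_esymm hP hPn hk, h3]
  ring

/-! ### Radial monotonicity at roots of unity -/

/-- If all roots of `P` lie in the closed unit disk, then `|P|` does not decrease radially on the
unit circle. -/
theorem re_mul_derivative_mul_conj_nonneg {P : Polynomial ℂ}
    (hroots : ∀ z : ℂ, P.IsRoot z → ‖z‖ ≤ 1) {w : ℂ} (hw : ‖w‖ = 1) :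
    0 ≤ (w * P.derivative.eval w * (starRingEnd ℂ) (P.eval w)).re := by
  by_cases h0 : P.eval w = 0
  · simp [h0]
  have hP0 : P ≠ 0 := by rintro rfl; simp at h0
  rw [(IsAlgClosed.splits P).eval_derivative_eq_eval_mul_sum h0]
  -- The quantity is |P(w)|² times Re Σ w/(w - z), and each summand has the sign of Re(w conj(w -
  -- z)) = 1 - Re(w conj z) ≥ 0.
  have h1 : w * (P.eval w * (P.roots.map fun z => 1 / (w - z)).sum) * (starRingEnd ℂ) (P.eval w) =
      (Complex.normSq (P.eval w) : ℝ) * (P.roots.map fun z => w * (1 / (w - z))).sum := by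
    rw [Multiset.sum_map_mul_left, Complex.normSq_eq_conj_mul_self]; ring
  rw [h1, Complex.re_ofReal_mul, Complex.re_multiset_sum_map]
  refine mul_nonneg (Complex.normSq_nonneg _) (Multiset.sum_nonneg ?_)
  intro x hx
  obtain ⟨z, hz, rfl⟩ := Multiset.mem_map.1 hx
  have hz1 := hroots z ((Polynomial.mem_roots hP0).1 hz)
  have h2 : w * (1 / (w - z)) = (w * (starRingEnd ℂ) (w - z)) * ((Complex.normSq (w - z))⁻¹ : ℝ) := by
    rw [one_div, Complex.inv_def]; ring
  rw [h2, Complex.re_mul_ofReal]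
  refine mul_nonneg ?_ (inv_nonneg.2 (Complex.normSq_nonneg _))
  have h3 : (w * (starRingEnd ℂ) (w - z)).re = 1 - (w * (starRingEnd ℂ) z).re := by
    rw [map_sub, mul_sub, Complex.sub_re, Complex.mul_conj, Complex.normSq_eq_norm_sq, hw]
    simp
  rw [h3]
  have : (w * (starRingEnd ℂ) z).re ≤ ‖w * (starRingEnd ℂ) z‖ := Complex.re_le_norm _
  rw [norm_mul, hw, Complex.norm_conj] at this
  linarith

/-- The value at `w` of the monic polynomial of degree `n` that vanishes at `b` and whose derivative
has the elementary symmetric functions `e k` of its roots. -/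
noncomputable def primitiveSum (n : ℕ) (e : ℕ → ℂ) (b : ℝ) (w : ℂ) : ℂ :=
  ∑ k ∈ Finset.range n, ((n / (n - k) : ℝ) : ℂ) *
    ((-1) ^ k * e k * (w ^ (n - k) - (b : ℂ) ^ (n - k)))

theorem norm_sum_range_le {m : ℕ} {F : ℕ → ℂ} {c : ℝ} (h : ∀ k < m, ‖F k‖ ≤ c) :
    ‖∑ k ∈ Finset.range m, F k‖ ≤ m * c := by
  refine (norm_sum_le _ _).trans
    ((Finset.sum_le_sum fun k hk => h k (Finset.mem_range.1 hk)).trans ?_)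
  simp

theorem div_sub_natCast_mem_Icc {n k : ℕ} (hk : k < n) :
    (1 : ℝ) ≤ n / (n - k) ∧ (n : ℝ) / (n - k) ≤ n := by
  have h1 : (k : ℝ) + 1 ≤ n := by exact_mod_cast hk
  have h2 : (0 : ℝ) ≤ k := Nat.cast_nonneg k
  constructor
  · rw [le_div_iff₀ (by linarith)]; linarith
  · rw [div_le_iff₀ (by linarith)]; nlinarith

theorem one_sub_pow_le_mul {ε : ℝ} (hε : 0 ≤ ε) (hε1 : ε ≤ 1) (m : ℕ) :
    0 ≤ 1 - (1 - ε) ^ m ∧ 1 - (1 - ε) ^ m ≤ m * ε := by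
  constructor
  · have := pow_le_one₀ (n := m) (by linarith : 0 ≤ 1 - ε) (by linarith)
    linarith
  · have := one_add_mul_le_pow (by linarith : (-2 : ℝ) ≤ -ε) m
    rw [← sub_eq_add_neg] at this
    linarith

theorem norm_pow_sub_pow_le_two {w : ℂ} (hw : ‖w‖ = 1) {b : ℝ} (hb0 : 0 ≤ b) (hb1 : b ≤ 1) (m : ℕ) :
    ‖w ^ m - (b : ℂ) ^ m‖ ≤ 2 := by
  refine (norm_sub_le _ _).trans ?_
  rw [norm_pow, hw, one_pow, norm_pow, Complex.norm_real, Real.norm_of_nonneg hb0]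
  linarith [pow_le_one₀ (n := m) hb0 hb1]

theorem norm_primitiveSum_term_le {n k : ℕ} {e : ℕ → ℂ} {τ b : ℝ} {w : ℂ} (hk : k < n)
    (he : ‖e k‖ ≤ τ) (hw : ‖w‖ = 1) (hb0 : 0 ≤ b) (hb1 : b ≤ 1) :
    ‖((n / (n - k) : ℝ) : ℂ) * ((-1) ^ k * e k * (w ^ (n - k) - (b : ℂ) ^ (n - k)))‖ ≤
      2 * n * τ := by
  obtain ⟨h1, h2⟩ := div_sub_natCast_mem_Icc hk
  rw [norm_mul, norm_mul, norm_mul, norm_pow, norm_neg, norm_one, one_pow, one_mul,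
    Complex.norm_real, Real.norm_of_nonneg (by linarith)]
  have h3 := mul_le_mul he (norm_pow_sub_pow_le_two hw hb0 hb1 (n - k)) (norm_nonneg _)
    ((norm_nonneg _).trans he)
  calc _ ≤ (n : ℝ) * (τ * 2) := mul_le_mul h2 h3 (by positivity) (by positivity)
    _ = _ := by ring

/-- If the critical points are of size `τ`, then the radial monotonicity on the unit circle bounds
the real part at a root of unity from below. -/
theorem neg_le_re_primitiveSum {n : ℕ} (hn : 1 ≤ n) {e : ℕ → ℂ} {ε τ β : ℝ} {w : ℂ} (he0 : e 0 = 1)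
    (hε : 0 ≤ ε) (hε1 : ε ≤ 1) (hτ : ε ≤ τ) (hβ : β = 1 - ε) (he : ∀ k, 1 ≤ k → k < n → ‖e k‖ ≤ τ)
    (hw : ‖w‖ = 1) (hwn : w ^ n = 1)
    (hre : 0 ≤ ((n * ∑ k ∈ Finset.range n, (-1) ^ k * e k * w ^ (n - k)) *
      (starRingEnd ℂ) (primitiveSum n e β w)).re) :
    -(2 * n ^ 3 * τ ^ 2) ≤ (primitiveSum n e β w).re := by
  set f := primitiveSum n e β w with hf
  set S := ∑ k ∈ Finset.range n, (-1) ^ k * e k * w ^ (n - k) with hS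
  have hτ0 : 0 ≤ τ := hε.trans hτ
  have hn0 : (1 : ℝ) ≤ n := by exact_mod_cast hn
  have hfn : ‖f‖ ≤ n * (2 * n * τ) := by
    rw [hf, primitiveSum]
    refine norm_sum_range_le fun k hk => ?_
    rcases Nat.eq_zero_or_pos k with rfl | hk0
    · have h1 := one_sub_pow_le_mul hε hε1 n
      rw [← hβ] at h1
      have : ((n / (n - (0 : ℕ)) : ℝ) : ℂ) * ((-1) ^ 0 * e 0 * (w ^ (n - 0) - (β : ℂ) ^ (n - 0))) =
          ((1 - β ^ n : ℝ) : ℂ) := by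
        have : (n : ℝ) ≠ 0 := by linarith
        simp [he0, hwn, this]
      rw [this, Complex.norm_real, Real.norm_of_nonneg h1.1]
      nlinarith
    · exact norm_primitiveSum_term_le hk (he k hk0 hk) hw (by linarith) (by linarith)
  -- Since wⁿ = 1, the leading term of S is 1 and that of f is 1 - βⁿ = O(ε). Thus S - 1 and f are
  -- both O(τ), and replacing S by 1 in Re(S conj f) ≥ 0 costs only O(τ²).
  have hSn : ‖S - 1‖ ≤ n * τ := by
    obtain ⟨m, rfl⟩ : ∃ m, n = m + 1 := ⟨n - 1, by omega⟩
    rw [hS, Finset.sum_range_succ']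
    simp only [pow_zero, he0, one_mul, Nat.sub_zero, hwn, add_sub_cancel_right]
    refine (norm_sum_range_le (c := τ) fun k hk => ?_).trans ?_
    · rw [norm_mul, norm_mul, norm_pow, norm_pow, hw, norm_neg, norm_one, one_pow, one_pow, one_mul,
        mul_one]
      exact he _ (by omega) (by omega)
    · push_cast
      nlinarith
  have h1 : 0 ≤ (S * (starRingEnd ℂ) f).re := by
    have : (n * S) * (starRingEnd ℂ) f = ((n : ℝ) : ℂ) * (S * (starRingEnd ℂ) f) := by
      push_cast; ring
    rw [this, Complex.re_ofReal_mul] at hre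
    exact nonneg_of_mul_nonneg_right hre (by linarith)
  have h2 : (S * (starRingEnd ℂ) f).re = f.re + ((S - 1) * (starRingEnd ℂ) f).re := by
    rw [sub_mul, one_mul, Complex.sub_re, Complex.conj_re]; ring
  have h3 : ((S - 1) * (starRingEnd ℂ) f).re ≤ n * τ * (n * (2 * n * τ)) := by
    refine (Complex.re_le_norm _).trans ?_
    rw [norm_mul, Complex.norm_conj]
    exact mul_le_mul hSn hfn (norm_nonneg _) (by positivity)
  nlinarith

theorem pow_sub_one_eq_conj {w : ℂ} {n : ℕ} (hn : 1 ≤ n) (hw : ‖w‖ = 1) (hwn : w ^ n = 1) :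
    w ^ (n - 1) = (starRingEnd ℂ) w := by
  have hw0 : w ≠ 0 := by rintro rfl; simp at hw
  have h1 : w ^ (n - 1) * w = 1 := by rw [← pow_succ, Nat.sub_add_cancel hn, hwn]
  have h2 : (starRingEnd ℂ) w * w = 1 := by
    rw [← Complex.normSq_eq_conj_mul_self, Complex.normSq_eq_norm_sq, hw]; simp
  exact mul_right_cancel₀ hw0 (h1.trans h2.symm)

theorem pow_sub_eq_conj_pow {w : ℂ} {n k : ℕ} (hk : k ≤ n) (hw : ‖w‖ = 1) (hwn : w ^ n = 1) :
    w ^ (n - k) = (starRingEnd ℂ) (w ^ k) := by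
  have hw0 : w ≠ 0 := by rintro rfl; simp at hw
  have h1 : w ^ (n - k) * w ^ k = 1 := by rw [← pow_add, Nat.sub_add_cancel hk, hwn]
  have h2 : (starRingEnd ℂ) (w ^ k) * w ^ k = 1 := by
    rw [← Complex.normSq_eq_conj_mul_self, Complex.normSq_eq_norm_sq, norm_pow, hw]; simp
  exact mul_right_cancel₀ (pow_ne_zero k hw0) (h1.trans h2.symm)

theorem exists_root_of_unity_im_pos {n : ℕ} (hn : 3 ≤ n) :
    ∃ w : ℂ, ‖w‖ = 1 ∧ w ^ n = 1 ∧ 0 < w.im := by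
  have hn3 : (3 : ℝ) ≤ n := by exact_mod_cast hn
  refine ⟨Complex.exp ((2 * Real.pi / n : ℝ) * Complex.I), Complex.norm_exp_ofReal_mul_I _, ?_, ?_⟩
  · rw [← Complex.exp_nat_mul]
    have : (n : ℂ) * ((2 * Real.pi / n : ℝ) * Complex.I) = 2 * Real.pi * Complex.I := by
      have : (n : ℂ) ≠ 0 := by exact_mod_cast (by omega : n ≠ 0)
      push_cast; field_simp
    rw [this, Complex.exp_two_pi_mul_I]
  · rw [Complex.exp_ofReal_mul_I_im]
    have := Real.pi_pos
    apply Real.sin_pos_of_pos_of_lt_pi (by positivity)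
    rw [div_lt_iff₀ (by linarith)]
    nlinarith

/-- The radial condition at every `n`-th root of unity. -/
def RadialCondition (n : ℕ) (e : ℕ → ℂ) (β : ℝ) : Prop :=
  ∀ w : ℂ, ‖w‖ = 1 → w ^ n = 1 →
    0 ≤ ((n * ∑ k ∈ Finset.range n, (-1) ^ k * e k * w ^ (n - k)) *
      (starRingEnd ℂ) (primitiveSum n e β w)).re

/-- A priori e₁ is only O(√ε), but the quadratic error at that scale is already O(ε). In Re P(w)
every term is then O(ε) except the multiple of Im e₁ · Im w, and w and its conjugate bound it with
both signs. The gain allows the radial condition to be used again at scale ε. -/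
theorem abs_im_first_le {n : ℕ} (hn : 3 ≤ n) (M : ℝ) (hM : 1 ≤ M) : ∃ C : ℝ, ∀ (e : ℕ → ℂ) (ε β : ℝ),
    e 0 = 1 → 0 ≤ ε → ε ≤ 1 → β = 1 - ε → |(e 1).re| ≤ M * ε →
    (∀ k, 1 ≤ k → k < n → ‖e k‖ ≤ M * √ε) → (∀ k, 2 ≤ k → k < n → ‖e k‖ ≤ M * ε) →
    RadialCondition n e β → |(e 1).im| ≤ C * ε := by
  obtain ⟨w₀, hw₀, hwn₀, hs₀⟩ := exists_root_of_unity_im_pos hn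
  set D : ℝ := 2 * n ^ 3 * M ^ 2 + n + 2 * n ^ 2 * M + 2 * n * M with hD
  refine ⟨D / w₀.im, ?_⟩
  intro e ε β he0 hε hε1 hβ hA he1 he2 hR
  have hn3 : (3 : ℝ) ≤ n := by exact_mod_cast hn
  have hsq : √ε ^ 2 = ε := Real.sq_sqrt hε
  have hεs : ε ≤ √ε := by
    have h0 := Real.sqrt_nonneg ε
    have h1 : √ε ≤ 1 := Real.sqrt_le_one.2 hε1
    nlinarith
  have hτ : ε ≤ M * √ε := by nlinarith [Real.sqrt_nonneg ε]
  obtain ⟨g1, g2⟩ := div_sub_natCast_mem_Icc (n := n) (k := 1) (by omega)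
  have key : ∀ w : ℂ, ‖w‖ = 1 → w ^ n = 1 → (e 1).im * w.im ≤ D * ε := by
    intro w hw hwn
    have hlow := neg_le_re_primitiveSum (by omega) he0 hε hε1 hτ hβ he1 hw hwn (hR w hw hwn)
    have hup : (primitiveSum n e β w).re ≤ n * ε +
        (n / (n - (1 : ℕ)) : ℝ) * (2 * M * ε - (e 1).im * w.im) + 2 * n ^ 2 * M * ε := by
      set g : ℝ := (n / (n - (1 : ℕ)) : ℝ) with hg
      have hsplit : primitiveSum n e β w = ((1 - β ^ n : ℝ) : ℂ) +
          (g : ℂ) * (-(e 1 * ((starRingEnd ℂ) w - ((β ^ (n - 1) : ℝ) : ℂ)))) +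
          ∑ k ∈ Finset.range (n - 2), ((n / (n - (k + 2 : ℕ)) : ℝ) : ℂ) *
            ((-1) ^ (k + 2) * e (k + 2) * (w ^ (n - (k + 2)) - (β : ℂ) ^ (n - (k + 2)))) := by
        rw [hg, ← pow_sub_one_eq_conj (by omega) hw hwn]
        have hnn : (n : ℝ) ≠ 0 := by linarith
        have hdd : ((n / (n - (0 : ℕ)) : ℝ) : ℂ) = 1 := by simp [hnn]
        have hr : Finset.range n = Finset.range (n - 2 + 1 + 1) := by congr 1; omega
        rw [primitiveSum, hr, Finset.sum_range_succ', Finset.sum_range_succ']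
        rw [hdd, he0]
        simp only [Nat.zero_add, Nat.sub_zero, hwn, pow_zero, pow_one, Nat.add_assoc]
        push_cast
        ring
      rw [hsplit, Complex.add_re, Complex.add_re, Complex.ofReal_re, Complex.re_ofReal_mul]
      have h1 := (one_sub_pow_le_mul hε hε1 n).2
      rw [← hβ] at h1
      have h2 : (-(e 1 * ((starRingEnd ℂ) w - ((β ^ (n - 1) : ℝ) : ℂ)))).re ≤
          2 * M * ε - (e 1).im * w.im := by
        have h3 : (-(e 1 * ((starRingEnd ℂ) w - ((β ^ (n - 1) : ℝ) : ℂ)))).re =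
            (e 1).re * (β ^ (n - 1) - w.re) - (e 1).im * w.im := by
          rw [Complex.neg_re, Complex.mul_re, Complex.sub_re, Complex.sub_im, Complex.conj_re,
            Complex.conj_im, Complex.ofReal_re, Complex.ofReal_im]
          ring
        have h4 : |β ^ (n - 1) - w.re| ≤ 2 := by
          have := (one_sub_pow_le_mul hε hε1 (n - 1)).1
          rw [← hβ] at this
          have h6 : 0 ≤ β ^ (n - 1) := pow_nonneg (by linarith) _
          have h5 := Complex.abs_re_le_norm w
          rw [hw, abs_le] at h5
          rw [abs_le]; constructor <;> linarith [h5.1, h5.2]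
        have h5 : (e 1).re * (β ^ (n - 1) - w.re) ≤ M * ε * 2 := by
          refine (le_abs_self _).trans ?_
          rw [abs_mul]
          exact mul_le_mul hA h4 (abs_nonneg _) (by positivity)
        rw [h3]; linarith
      have h3 := mul_le_mul_of_nonneg_left h2 (by linarith : 0 ≤ g)
      have h4 : (∑ k ∈ Finset.range (n - 2), ((n / (n - (k + 2 : ℕ)) : ℝ) : ℂ) *
            ((-1) ^ (k + 2) * e (k + 2) * (w ^ (n - (k + 2)) - (β : ℂ) ^ (n - (k + 2))))).re ≤
          2 * n ^ 2 * M * ε := by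
        refine (Complex.re_le_norm _).trans ?_
        refine (norm_sum_range_le (c := 2 * n * (M * ε)) fun k hk => ?_).trans ?_
        · exact norm_primitiveSum_term_le (by omega) (he2 _ (by omega) (by omega)) hw (by linarith)
            (by linarith)
        · have : ((n - 2 : ℕ) : ℝ) ≤ n := by exact_mod_cast Nat.sub_le n 2
          calc _ ≤ (n : ℝ) * (2 * n * (M * ε)) := mul_le_mul_of_nonneg_right this (by positivity)
            _ = _ := by ring
      linarith
    have hMs : (M * √ε) ^ 2 = M ^ 2 * ε := by rw [mul_pow, hsq]
    rw [hMs] at hlow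
    have h5 : (n / (n - (1 : ℕ)) : ℝ) * (2 * M * ε) ≤ n * (2 * M * ε) :=
      mul_le_mul_of_nonneg_right g2 (by positivity)
    have h6 : (n / (n - (1 : ℕ)) : ℝ) * ((e 1).im * w.im) ≤ D * ε := by
      rw [hD]; linarith
    -- The factor n/(n-1) is at least 1, so it can be dropped when the product is nonnegative.
    rcases le_total ((e 1).im * w.im) 0 with h7 | h7
    · exact h7.trans (by positivity)
    · nlinarith
  rw [div_mul_eq_mul_div, le_div_iff₀ hs₀]
  have k1 := key w₀ hw₀ hwn₀
  have k2 := key ((starRingEnd ℂ) w₀) (by rwa [Complex.norm_conj])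
    (by rw [← map_pow, hwn₀, map_one])
  rw [Complex.conj_im] at k2
  rcases abs_cases (e 1).im with ⟨h, -⟩ | ⟨h, -⟩ <;> rw [h] <;> linarith

/-- Pairing w with its conjugate removes Im eₖ. This is needed because e₃ itself is only O(ε^(3/2)),
while its real part is O(ε²). -/
theorem re_primitiveSum_add_conj {n : ℕ} (e : ℕ → ℂ) (β : ℝ) (w : ℂ) :
    (primitiveSum n e β w).re + (primitiveSum n e β ((starRingEnd ℂ) w)).re =
      2 * ∑ k ∈ Finset.range n, (n / (n - k) : ℝ) *
        ((-1) ^ k * (e k).re * ((w ^ (n - k)).re - β ^ (n - k))) := by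
  rw [← Complex.add_re, primitiveSum, primitiveSum, ← Finset.sum_add_distrib, Complex.re_sum,
    Finset.mul_sum]
  refine Finset.sum_congr rfl fun k _ => ?_
  rw [← mul_add, Complex.re_ofReal_mul, ← map_pow]
  have h1 : ∀ z : ℂ, (-1) ^ k * e k * (z - (β : ℂ) ^ (n - k)) +
      (-1) ^ k * e k * ((starRingEnd ℂ) z - (β : ℂ) ^ (n - k)) =
      (((-1) ^ k * (2 * (z.re - β ^ (n - k))) : ℝ) : ℂ) * e k := by
    intro z
    have := Complex.add_conj z
    push_cast
    push_cast at this
    linear_combination (-1) ^ k * e k * this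
  rw [h1, Complex.re_ofReal_mul]
  ring

/-- With errors now O(ε²), only k = 0, 1, 2 contribute to first order. Powers of β are replaced by
1, and for c = Re w the factor of e₂ becomes (2c² - 1) - 1 = -2(1 - c)(1 + c). -/
theorem linear_constraint {n : ℕ} (hn : 3 ≤ n) (M : ℝ) (hM : 1 ≤ M) : ∃ C : ℝ, ∀ (e : ℕ → ℂ)
    (ε β Y : ℝ), e 0 = 1 → 0 ≤ ε → ε ≤ 1 → β = 1 - ε → 0 ≤ Y → Y ≤ M * ε →
    |(e 2).re - Y| ≤ M * ε ^ 2 → (∀ k, 1 ≤ k → k < n → ‖e k‖ ≤ M * ε) →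
    (∀ k, 3 ≤ k → k < n → |(e k).re| ≤ M * ε ^ 2) → RadialCondition n e β →
    ∀ w : ℂ, ‖w‖ = 1 → w ^ n = 1 →
      -(C * ε ^ 2) ≤ ε + (e 1).re * (1 - w.re) / (n - 1) -
        2 * Y * ((1 - w.re) * (1 + w.re)) / (n - 2) := by
  refine ⟨(2 * n ^ 3 * M ^ 2 + n * M * n + n * (2 * M + n * M) + 2 * n ^ 2 * M) / n, ?_⟩
  intro e ε β Y he0 hε hε1 hβ hY0 hY hE2 he hre hR w hw hwn
  have hn3 : (3 : ℝ) ≤ n := by exact_mod_cast hn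
  have hτ : ε ≤ M * ε := by nlinarith
  have h1 := neg_le_re_primitiveSum (by omega) he0 hε hε1 hτ hβ he hw hwn (hR w hw hwn)
  have hwc : ‖(starRingEnd ℂ) w‖ = 1 := by rwa [Complex.norm_conj]
  have hwnc : ((starRingEnd ℂ) w) ^ n = 1 := by rw [← map_pow, hwn, map_one]
  have h2 := neg_le_re_primitiveSum (by omega) he0 hε hε1 hτ hβ he hwc hwnc (hR _ hwc hwnc)
  have h3 := re_primitiveSum_add_conj (n := n) e β w
  set F := ∑ k ∈ Finset.range n, (n / (n - k) : ℝ) *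
        ((-1) ^ k * (e k).re * ((w ^ (n - k)).re - β ^ (n - k))) with hF
  have hlow : -(2 * n ^ 3 * (M * ε) ^ 2) ≤ F := by linarith
  set g₁ : ℝ := n / (n - (1 : ℕ)) with hg₁
  set g₂ : ℝ := n / (n - (2 : ℕ)) with hg₂
  obtain ⟨g1, g1'⟩ := div_sub_natCast_mem_Icc (n := n) (k := 1) (by omega)
  obtain ⟨g2, g2'⟩ := div_sub_natCast_mem_Icc (n := n) (k := 2) (by omega)
  rw [← hg₁] at g1 g1'
  rw [← hg₂] at g2 g2'
  have hw2 : w.re ^ 2 + w.im ^ 2 = 1 := by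
    have := Complex.normSq_apply w
    rw [Complex.normSq_eq_norm_sq, hw] at this
    linarith
  have hc1 : (w ^ (n - 1)).re = w.re := by
    rw [pow_sub_eq_conj_pow (by omega) hw hwn, pow_one, Complex.conj_re]
  have hc2 : (w ^ (n - 2)).re = 2 * w.re ^ 2 - 1 := by
    rw [pow_sub_eq_conj_pow (by omega) hw hwn, Complex.conj_re, pow_two, Complex.mul_re]
    linarith
  have hsplit : F = (1 - β ^ n) + g₁ * (-((e 1).re * (w.re - β ^ (n - 1)))) +
      g₂ * ((e 2).re * (2 * w.re ^ 2 - 1 - β ^ (n - 2))) +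
      ∑ k ∈ Finset.range (n - 3), (n / (n - (k + 3 : ℕ)) : ℝ) *
        ((-1) ^ (k + 3) * (e (k + 3)).re * ((w ^ (n - (k + 3))).re - β ^ (n - (k + 3)))) := by
    have hnn : (n : ℝ) ≠ 0 := by linarith
    have hdd : (n / (n - (0 : ℕ)) : ℝ) = 1 := by simp [hnn]
    have hr : Finset.range n = Finset.range (n - 3 + 1 + 1 + 1) := by congr 1; omega
    rw [hF, hr, Finset.sum_range_succ', Finset.sum_range_succ', Finset.sum_range_succ', hdd, he0]
    simp only [Nat.zero_add, Nat.sub_zero, hwn, pow_zero, pow_one, Nat.add_assoc,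
      Nat.reduceAdd, hc1, hc2, Complex.one_re]
    rw [← hg₁, ← hg₂]
    ring
  have t0 := (one_sub_pow_le_mul hε hε1 n).2
  rw [← hβ] at t0
  have hA : |(e 1).re| ≤ M * ε := (Complex.abs_re_le_norm _).trans (he 1 le_rfl (by omega))
  have t1 : g₁ * (-((e 1).re * (w.re - β ^ (n - 1)))) ≤
      g₁ * ((e 1).re * (1 - w.re)) + n * M * n * ε ^ 2 := by
    obtain ⟨b1, b2⟩ := one_sub_pow_le_mul hε hε1 (n - 1)
    rw [← hβ] at b1 b2
    have b3 : ((n - 1 : ℕ) : ℝ) ≤ n := by exact_mod_cast Nat.sub_le n 1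
    have b4 : 1 - β ^ (n - 1) ≤ n * ε := b2.trans (mul_le_mul_of_nonneg_right b3 hε)
    have b5 : |(e 1).re * (1 - β ^ (n - 1))| ≤ M * ε * (n * ε) := by
      rw [abs_mul, abs_of_nonneg b1]
      exact mul_le_mul hA b4 b1 (by positivity)
    have b6 : -((e 1).re * (1 - β ^ (n - 1))) ≤ M * ε * (n * ε) := by
      linarith [(abs_le.1 b5).1]
    have b7 : g₁ * (-((e 1).re * (1 - β ^ (n - 1)))) ≤ n * (M * ε * (n * ε)) := by
      calc _ ≤ g₁ * (M * ε * (n * ε)) := mul_le_mul_of_nonneg_left b6 (by linarith)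
        _ ≤ _ := mul_le_mul_of_nonneg_right g1' (by positivity)
    linarith
  have t2 : g₂ * ((e 2).re * (2 * w.re ^ 2 - 1 - β ^ (n - 2))) ≤
      g₂ * (-(2 * Y * ((1 - w.re) * (1 + w.re)))) + n * (2 * M + n * M) * ε ^ 2 := by
    obtain ⟨b1, b2⟩ := one_sub_pow_le_mul hε hε1 (n - 2)
    rw [← hβ] at b1 b2
    have b3 : ((n - 2 : ℕ) : ℝ) ≤ n := by exact_mod_cast Nat.sub_le n 2
    have b4 : 1 - β ^ (n - 2) ≤ n * ε := b2.trans (mul_le_mul_of_nonneg_right b3 hε)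
    have b0 : 0 ≤ β ^ (n - 2) := pow_nonneg (by linarith) _
    have b5 : |2 * w.re ^ 2 - 1 - β ^ (n - 2)| ≤ 2 := by
      rw [abs_le]; constructor <;> nlinarith [sq_nonneg w.im, sq_nonneg w.re]
    have b6 : ((e 2).re - Y) * (2 * w.re ^ 2 - 1 - β ^ (n - 2)) ≤ M * ε ^ 2 * 2 := by
      refine (le_abs_self _).trans ?_
      rw [abs_mul]
      exact mul_le_mul hE2 b5 (abs_nonneg _) (by positivity)
    have b7 : Y * (1 - β ^ (n - 2)) ≤ M * ε * (n * ε) := mul_le_mul hY b4 b1 (by positivity)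
    have b8 : (e 2).re * (2 * w.re ^ 2 - 1 - β ^ (n - 2)) ≤
        -(2 * Y * ((1 - w.re) * (1 + w.re))) + (2 * M + n * M) * ε ^ 2 := by
      linarith
    have b9 := mul_le_mul_of_nonneg_left b8 (by linarith : 0 ≤ g₂)
    have b10 : g₂ * ((2 * M + n * M) * ε ^ 2) ≤ n * ((2 * M + n * M) * ε ^ 2) :=
      mul_le_mul_of_nonneg_right g2' (by positivity)
    linarith
  have t3 : ∑ k ∈ Finset.range (n - 3), (n / (n - (k + 3 : ℕ)) : ℝ) *
        ((-1) ^ (k + 3) * (e (k + 3)).re * ((w ^ (n - (k + 3))).re - β ^ (n - (k + 3)))) ≤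
      2 * n ^ 2 * M * ε ^ 2 := by
    have : ∀ k ∈ Finset.range (n - 3), (n / (n - (k + 3 : ℕ)) : ℝ) *
        ((-1) ^ (k + 3) * (e (k + 3)).re * ((w ^ (n - (k + 3))).re - β ^ (n - (k + 3)))) ≤
        n * (M * ε ^ 2 * 2) := by
      intro k hk
      rw [Finset.mem_range] at hk
      obtain ⟨q1, q2⟩ := div_sub_natCast_mem_Icc (n := n) (k := k + 3) (by omega)
      have c1 : |(w ^ (n - (k + 3))).re - β ^ (n - (k + 3))| ≤ 2 := by
        have := (Complex.abs_re_le_norm _).trans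
          (norm_pow_sub_pow_le_two hw (b := β) (by linarith) (by linarith) (n - (k + 3)))
        rwa [Complex.sub_re, ← Complex.ofReal_pow, Complex.ofReal_re] at this
      have c2 : |(-1) ^ (k + 3) * (e (k + 3)).re * ((w ^ (n - (k + 3))).re - β ^ (n - (k + 3)))| ≤
          M * ε ^ 2 * 2 := by
        rw [abs_mul, abs_mul, abs_pow, abs_neg, abs_one, one_pow, one_mul]
        exact mul_le_mul (hre _ (by omega) (by omega)) c1 (abs_nonneg _) (by positivity)
      calc _ ≤ (n / (n - (k + 3 : ℕ)) : ℝ) * (M * ε ^ 2 * 2) :=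
            mul_le_mul_of_nonneg_left ((le_abs_self _).trans c2) (by linarith)
        _ ≤ _ := mul_le_mul_of_nonneg_right q2 (by positivity)
    refine (Finset.sum_le_sum this).trans ?_
    simp only [Finset.sum_const, Finset.card_range, nsmul_eq_mul]
    have b3 : ((n - 3 : ℕ) : ℝ) ≤ n := by exact_mod_cast Nat.sub_le n 3
    calc _ ≤ (n : ℝ) * (n * (M * ε ^ 2 * 2)) := mul_le_mul_of_nonneg_right b3 (by positivity)
      _ = _ := by ring
  have hfin : 0 ≤ (n : ℝ) * (ε + (e 1).re * (1 - w.re) / (n - 1) -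
        2 * Y * ((1 - w.re) * (1 + w.re)) / (n - 2)) +
      (2 * n ^ 3 * M ^ 2 + n * M * n + n * (2 * M + n * M) + 2 * n ^ 2 * M) * ε ^ 2 := by
    have r1 : (n : ℝ) * ((e 1).re * (1 - w.re) / (n - 1)) = g₁ * ((e 1).re * (1 - w.re)) := by
      rw [hg₁, Nat.cast_one]; ring
    have r2 : (n : ℝ) * (2 * Y * ((1 - w.re) * (1 + w.re)) / (n - 2)) =
        g₂ * (2 * Y * ((1 - w.re) * (1 + w.re))) := by
      rw [hg₂, Nat.cast_ofNat]; ring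
    rw [mul_sub, mul_add, r1, r2]
    rw [hsplit] at hlow
    linarith
  have hn0 : (0 : ℝ) < n := by linarith
  rw [div_mul_eq_mul_div, neg_le_iff_add_nonneg, ← mul_nonneg_iff_of_pos_left hn0, mul_add,
    mul_div_cancel₀ _ hn0.ne']
  exact hfin

/-! ### Size of the symmetric functions -/

theorem norm_le_of_re_im {C ε : ℝ} (hC : 1 ≤ C) (hε : 0 ≤ ε) (hε1 : ε ≤ 1) {z : ℂ}
    (h : |z.re| ≤ C * ε ∧ z.im ^ 2 ≤ C * ε) : ‖z‖ ≤ 2 * C * √ε := by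
  have h0 := Real.sqrt_nonneg ε
  have hsq : √ε ^ 2 = ε := Real.sq_sqrt hε
  have h1 : √ε ≤ 1 := Real.sqrt_le_one.2 hε1
  have hre : |z.re| ≤ C * √ε := h.1.trans (mul_le_mul_of_nonneg_left (by nlinarith) (by linarith))
  have him : |z.im| ≤ C * √ε := by
    apply abs_le_of_sq_le_sq _ (by positivity)
    rw [mul_pow, hsq]
    refine h.2.trans (mul_le_mul_of_nonneg_right ?_ hε)
    nlinarith
  linarith [Complex.norm_le_abs_re_add_abs_im z]

/-- The critical points are O(√ε), so eₖ is O(ε^(k/2)). The free exponent j ≤ k serves the later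
uses with j = 1, 2 and 4. -/
theorem exists_esymm_bound (n : ℕ) (C : ℝ) (hC : 1 ≤ C) : ∃ M : ℝ, 1 ≤ M ∧
    ∀ (s : Multiset ℂ) (ε : ℝ), s.card ≤ n → 0 ≤ ε → ε ≤ 1 →
      (∀ z ∈ s, |z.re| ≤ C * ε ∧ z.im ^ 2 ≤ C * ε) →
      |s.sum.re| ≤ M * ε ∧ ∀ j k : ℕ, j ≤ k → k ≤ n → ‖s.esymm k‖ ≤ M * √ε ^ j := by
  have hCn : 1 ≤ (2 * C) ^ n := one_le_pow₀ (by linarith)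
  have h2n : (1 : ℝ) ≤ 2 ^ n := one_le_pow₀ (by norm_num)
  have hnC : 0 ≤ n * C := by positivity
  refine ⟨2 ^ n * (2 * C) ^ n + n * C, by nlinarith, ?_⟩
  intro s ε hs hε hε1 h
  have h0 := Real.sqrt_nonneg ε
  have h1 : √ε ≤ 1 := Real.sqrt_le_one.2 hε1
  constructor
  · have e1 := Complex.re_multiset_sum_map s id
    rw [Multiset.map_id] at e1
    rw [e1]
    refine (Multiset.abs_sum_map_le s _ fun z hz => (h z hz).1).trans ?_
    have e2 : (s.card : ℝ) * (C * ε) ≤ n * (C * ε) :=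
      mul_le_mul_of_nonneg_right (by exact_mod_cast hs) (by positivity)
    have e3 : 0 ≤ 2 ^ n * (2 * C) ^ n * ε := by positivity
    linarith
  · intro j k hjk hk
    refine (s.norm_esymm_le (fun z hz => norm_le_of_re_im hC hε hε1 (h z hz)) (by positivity)
      k).trans ?_
    rw [mul_pow, ← mul_assoc]
    refine mul_le_mul ?_ (pow_le_pow_of_le_one h0 h1 hjk) (by positivity) (by positivity)
    have e1 : (2 : ℝ) ^ s.card ≤ 2 ^ n := pow_le_pow_right₀ (by norm_num) hs
    have e2 : (2 * C) ^ k ≤ (2 * C) ^ n := pow_le_pow_right₀ (by linarith) hk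
    linarith [mul_le_mul e1 e2 (by positivity) (by positivity)]

/-- Newton's identities: the power sum p₁ is O(ε) and Re p₂ is -Σ (Im z)² up to O(ε²), which gives
e₂. For e₃, the terms p₁³ and p₁p₂ are O(ε²), and Re z³ = x(x² - 3y²) is O(ε²) since x = O(ε) and y²
= O(ε). -/
theorem exists_re_esymm_bound (n : ℕ) (C M : ℝ) (hC : 1 ≤ C) (hM : 1 ≤ M) : ∃ M' : ℝ,
    ∀ (s : Multiset ℂ) (ε : ℝ), s.card ≤ n → 0 ≤ ε → ε ≤ 1 →
      (∀ z ∈ s, |z.re| ≤ C * ε ∧ z.im ^ 2 ≤ C * ε) → |s.sum.re| ≤ M * ε → |s.sum.im| ≤ M * ε →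
      |(s.esymm 2).re - (s.map fun z => z.im ^ 2).sum / 2| ≤ M' * ε ^ 2 ∧
      |(s.esymm 3).re| ≤ M' * ε ^ 2 := by
  refine ⟨2 * M ^ 2 + n * C ^ 2 + (8 * M ^ 3 + 24 * M * n * C ^ 2 + 2 * (n * (4 * C ^ 3))), ?_⟩
  intro s ε hs hε hε1 h hA hT
  have hs' : (s.card : ℝ) ≤ n := by exact_mod_cast hs
  have hA2 : s.sum.re ^ 2 ≤ M ^ 2 * ε ^ 2 := by
    rw [← mul_pow, ← sq_abs]; exact pow_le_pow_left₀ (abs_nonneg _) hA 2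
  have hT2 : s.sum.im ^ 2 ≤ M ^ 2 * ε ^ 2 := by
    rw [← mul_pow, ← sq_abs]; exact pow_le_pow_left₀ (abs_nonneg _) hT 2
  have hε32 : ε ^ 3 ≤ ε ^ 2 := pow_le_pow_of_le_one hε hε1 (by norm_num)
  have hx2 : ∀ z ∈ s, z.re ^ 2 ≤ C ^ 2 * ε ^ 2 := fun z hz => by
    rw [← mul_pow, ← sq_abs]; exact pow_le_pow_left₀ (abs_nonneg _) (h z hz).1 2
  have hp1 : ‖s.sum‖ ≤ 2 * M * ε := by linarith [Complex.norm_le_abs_re_add_abs_im s.sum]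
  have hp2 : ‖(s.map (· ^ 2)).sum‖ ≤ n * (4 * C ^ 2 * ε) := by
    have e1 : ‖(s.map (· ^ 2)).sum‖ ≤ (s.map fun z => ‖z‖ ^ 2).sum := by
      have := norm_multiset_sum_le (s.map (· ^ 2))
      simpa [Multiset.map_map, Function.comp_def] using this
    refine e1.trans ((le_abs_self _).trans
      ((Multiset.abs_sum_map_le s _ (c := 4 * C ^ 2 * ε) fun z hz => ?_).trans ?_))
    · rw [abs_of_nonneg (by positivity)]
      refine (pow_le_pow_left₀ (norm_nonneg _) (norm_le_of_re_im hC hε hε1 (h z hz)) 2).trans ?_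
      rw [mul_pow, Real.sq_sqrt hε, mul_pow]; norm_num
    · exact mul_le_mul_of_nonneg_right hs' (by positivity)
  have hp3 : |(s.map (· ^ 3)).sum.re| ≤ n * (4 * C ^ 3 * ε ^ 2) := by
    rw [Complex.re_multiset_sum_map]
    refine (Multiset.abs_sum_map_le s _ (c := 4 * C ^ 3 * ε ^ 2) fun z hz => ?_).trans
      (mul_le_mul_of_nonneg_right hs' (by positivity))
    obtain ⟨hx, hy⟩ := h z hz
    have e1 : (z ^ 3).re = z.re * (z.re ^ 2 - 3 * z.im ^ 2) := by
      rw [pow_succ, pow_two]; simp only [Complex.mul_re, Complex.mul_im]; ring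
    have e2 : |z.re ^ 2 - 3 * z.im ^ 2| ≤ 4 * C ^ 2 * ε := by
      have hx2' := hx2 z hz
      have hεε : ε ^ 2 ≤ ε := by nlinarith
      have e3 : C ^ 2 * ε ^ 2 ≤ C ^ 2 * ε := mul_le_mul_of_nonneg_left hεε (by positivity)
      have e4 : C * ε ≤ C ^ 2 * ε := mul_le_mul_of_nonneg_right (by nlinarith) hε
      rw [abs_le]; constructor <;> nlinarith [sq_nonneg z.re, sq_nonneg z.im]
    rw [e1, abs_mul]
    calc _ ≤ C * ε * (4 * C ^ 2 * ε) := mul_le_mul hx e2 (abs_nonneg _) (by positivity)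
      _ = _ := by ring
  have hpos1 : 0 ≤ (8 * M ^ 3 + 24 * M * n * C ^ 2 + 2 * (n * (4 * C ^ 3))) * ε ^ 2 := by positivity
  have hpos2 : 0 ≤ (2 * M ^ 2 + n * C ^ 2) * ε ^ 2 := by positivity
  constructor
  · have e2 := congrArg Complex.re (Multiset.two_mul_esymm_two s)
    have e3 : (2 * s.esymm 2).re = 2 * (s.esymm 2).re := by simp
    have e4 : (s.map fun z => (z ^ 2).re).sum =
        (s.map fun z => z.re ^ 2).sum - (s.map fun z => z.im ^ 2).sum := by
      rw [← Multiset.sum_map_sub]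
      congr 1
      refine Multiset.map_congr rfl fun z _ => ?_
      rw [pow_two, Complex.mul_re]; ring
    rw [e3, Complex.sub_re, Complex.re_multiset_sum_map, e4, pow_two s.sum, Complex.mul_re] at e2
    have e5 := (Multiset.abs_sum_map_le s (fun z => z.re ^ 2) (c := C ^ 2 * ε ^ 2) fun z hz => by
      rw [abs_of_nonneg (sq_nonneg _)]; exact hx2 z hz).trans
      (mul_le_mul_of_nonneg_right hs' (by positivity))
    rw [abs_le] at e5
    rw [abs_le]
    constructor <;> nlinarith [sq_nonneg s.sum.re, sq_nonneg s.sum.im]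
  · have e2 := congrArg Complex.re (Multiset.six_mul_esymm_three s)
    have e3 : (6 * s.esymm 3).re = 6 * (s.esymm 3).re := by simp
    have e4 : (2 * (s.map (· ^ 3)).sum).re = 2 * (s.map (· ^ 3)).sum.re := by simp
    rw [e3, Complex.add_re, Complex.sub_re, e4] at e2
    have e5 : |(s.sum ^ 3).re| ≤ 8 * M ^ 3 * ε ^ 2 := by
      refine (Complex.abs_re_le_norm _).trans ?_
      rw [norm_pow]
      calc _ ≤ (2 * M * ε) ^ 3 := pow_le_pow_left₀ (norm_nonneg _) hp1 3
        _ = 8 * M ^ 3 * ε ^ 3 := by ring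
        _ ≤ _ := mul_le_mul_of_nonneg_left hε32 (by positivity)
    have e6 : |(3 * s.sum * (s.map (· ^ 2)).sum).re| ≤ 24 * M * n * C ^ 2 * ε ^ 2 := by
      refine (Complex.abs_re_le_norm _).trans ?_
      rw [norm_mul, norm_mul]
      have := mul_le_mul hp1 hp2 (norm_nonneg _) (by positivity)
      have h3 : ‖(3 : ℂ)‖ = 3 := by simp
      rw [h3]
      nlinarith
    rw [abs_le] at e5 e6 hp3
    rw [abs_le]
    constructor <;> linarith

/-! ### The upper bound -/

/-- Averaging the linear constraints with the dual weights eliminates the roots of unity. -/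
theorem averaged_constraint {n : ℕ} (hn : 3 ≤ n) {ε A Y C₂ : ℝ} (hε : 0 ≤ ε) (hY0 : 0 ≤ Y)
    (hcons : ∀ w : ℂ, w ^ n = 1 → -(C₂ * ε ^ 2) ≤ ε + A * (1 - w.re) / (n - 1) -
      2 * Y * ((1 - w.re) * (1 + w.re)) / (n - 2)) :
    -(7 / 10) * (ε + |C₂| * ε ^ 2) + Y / (n - 1) ≤ A / (n - 1) := by
  have hn3 : (3 : ℝ) ≤ n := by exact_mod_cast hn
  obtain ⟨ω₁, ω₂, p, hω₁, hω₂, hp0, hp1, hu₁, hu₂, hmean, hinv⟩ := hasDualWeights hn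
  have hdiv : ∀ w : ℂ, w ^ n = 1 → 0 < 1 - w.re →
      -(ε + |C₂| * ε ^ 2) * (1 / (1 - w.re)) + 2 * Y / (n - 2) * (2 - (1 - w.re)) ≤
        A / (n - 1) := by
    intro w hw hu
    have h1 := hcons w hw
    have h2 : C₂ * ε ^ 2 ≤ |C₂| * ε ^ 2 := mul_le_mul_of_nonneg_right (le_abs_self _) (by positivity)
    rw [← mul_le_mul_iff_left₀ hu]
    have h3 : (-(ε + |C₂| * ε ^ 2) * (1 / (1 - w.re)) + 2 * Y / (n - 2) * (2 - (1 - w.re))) *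
        (1 - w.re) = -(ε + |C₂| * ε ^ 2) + 2 * Y * ((1 - w.re) * (1 + w.re)) / (n - 2) := by
      field_simp; ring
    rw [h3]
    have h4 : A / (n - 1) * (1 - w.re) = A * (1 - w.re) / (n - 1) := by ring
    linarith
  have h1 := mul_le_mul_of_nonneg_left (hdiv ω₁ hω₁ hu₁) hp0
  have h2 := mul_le_mul_of_nonneg_left (hdiv ω₂ hω₂ hu₂) (by linarith : 0 ≤ 1 - p)
  have h3 : (ε + |C₂| * ε ^ 2) * (p / (1 - ω₁.re) + (1 - p) / (1 - ω₂.re)) ≤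
      (ε + |C₂| * ε ^ 2) * (7 / 10) := mul_le_mul_of_nonneg_left hinv (by positivity)
  have hn2 : (0 : ℝ) < n - 2 := by linarith
  have hn1 : (0 : ℝ) < n - 1 := by linarith
  -- The mean (3n-2)/(2(n-1)) is chosen so that 2(2 - E[u])/(n-2) is at least 1/(n-1), which makes Y
  -- cancel against the averaged distance bound.
  have h4 : Y / (n - 1) ≤ 2 * Y / (n - 2) * (2 - (p * (1 - ω₁.re) + (1 - p) * (1 - ω₂.re))) := by
    calc Y / (n - 1) = 2 * Y / (n - 2) * (2 - (3 * n - 2) / (2 * (n - 1))) := by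
          field_simp; ring
      _ ≤ _ := mul_le_mul_of_nonneg_left (by linarith) (by positivity)
  have h5 : (ε + |C₂| * ε ^ 2) * (p / (1 - ω₁.re) + (1 - p) / (1 - ω₂.re)) =
    p * ((ε + |C₂| * ε ^ 2) * (1 / (1 - ω₁.re))) +
      (1 - p) * ((ε + |C₂| * ε ^ 2) * (1 / (1 - ω₂.re))) := by ring
  linarith

/-- The minimum of |β - ζ|² is at most its average, and (Re ζ)² is negligible. Only the sums of Re ζ
and (Im ζ)² remain. -/
theorem averaged_dist_bound {n : ℕ} (hn : 3 ≤ n) {s : Multiset ℂ} {β ε r C : ℝ}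
    (hcard : s.card = n - 1) (hr0 : 0 ≤ r) (hbd : ∀ z ∈ s, |z.re| ≤ C * ε)
    (hcrit : ∀ z ∈ s, r ≤ ‖(β : ℂ) - z‖) :
    r ^ 2 - β ^ 2 - C ^ 2 * ε ^ 2 ≤ -(2 * β * (s.sum.re / (n - 1))) +
      2 * ((s.map fun z => z.im ^ 2).sum / 2 / (n - 1)) := by
  have hn3 : (3 : ℝ) ≤ n := by exact_mod_cast hn
  have hn1' : ((n - 1 : ℕ) : ℝ) = (n : ℝ) - 1 := by
    rw [Nat.cast_sub (by omega)]; simp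
  set A := s.sum.re with hAdef
  set Y := (s.map fun z => z.im ^ 2).sum / 2 with hY
  have hdist : ∀ z ∈ s, r ^ 2 - β ^ 2 - C ^ 2 * ε ^ 2 ≤ -(2 * β * z.re) + z.im ^ 2 := by
    intro z hz
    have h1 : r ^ 2 ≤ ‖(β : ℂ) - z‖ ^ 2 := by
      have := hcrit z hz
      exact pow_le_pow_left₀ hr0 this 2
    rw [← Complex.normSq_eq_norm_sq, Complex.normSq_apply] at h1
    simp only [Complex.sub_re, Complex.sub_im, Complex.ofReal_re, Complex.ofReal_im] at h1
    have h2 : z.re ^ 2 ≤ C ^ 2 * ε ^ 2 := by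
      rw [← mul_pow, ← sq_abs]; exact pow_le_pow_left₀ (abs_nonneg _) (hbd z hz) 2
    nlinarith
  have hsumdist : ((n : ℝ) - 1) * (r ^ 2 - β ^ 2 - C ^ 2 * ε ^ 2) ≤ -(2 * β * A) + 2 * Y := by
    have h1 := Multiset.card_nsmul_le_sum (s := s.map fun z => -(2 * β * z.re) + z.im ^ 2)
      (a := r ^ 2 - β ^ 2 - C ^ 2 * ε ^ 2) (by
        intro x hx
        obtain ⟨z, hz, rfl⟩ := Multiset.mem_map.1 hx
        exact hdist z hz)
    rw [Multiset.card_map, hcard, nsmul_eq_mul, hn1', Multiset.sum_map_add] at h1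
    have h2 : (s.map fun z => -(2 * β * z.re)).sum = -(2 * β * A) := by
      have e1 := Complex.re_multiset_sum_map s id
      rw [Multiset.map_id] at e1
      rw [hAdef, e1, ← neg_mul, ← Multiset.sum_map_mul_left]
      simp only [neg_mul, id]
    rw [h2] at h1
    rw [hY]; linarith
  have hn1 : (0 : ℝ) < n - 1 := by linarith
  rw [← mul_le_mul_iff_right₀ hn1]
  refine hsumdist.trans (le_of_eq ?_)
  field_simp

/-- The Sendov bound with linear coefficient `3/10` for a single monic polynomial. -/
theorem exists_dist_bound {n : ℕ} (hn : 3 ≤ n) : ∃ K : ℝ, 0 ≤ K ∧ ∃ δ : ℝ, 0 < δ ∧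
    ∀ (β ε r : ℝ) (P : Polynomial ℂ), 0 ≤ ε → ε ≤ δ → β = 1 - ε → 1 - 3 / 10 * ε ≤ r → P.Monic →
      P.natDegree = n → (∀ z : ℂ, P.IsRoot z → ‖z‖ ≤ 1) → P.IsRoot β →
      (∀ ζ ∈ P.derivative.roots, r ≤ ‖(β : ℂ) - ζ‖) →
      r ≤ 1 - 3 / 10 * ε + K * ε ^ 2 := by
  obtain ⟨C₀, -, δ, hδ, hδ1, hloc⟩ := exists_criticalPoint_bound n (by omega)
  set C := max 1 C₀ with hCdef
  have hC : 1 ≤ C := le_max_left _ _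
  obtain ⟨M₁, hM₁, hes⟩ := exists_esymm_bound n C hC
  obtain ⟨C₁, him⟩ := abs_im_first_le hn M₁ hM₁
  set M₂ := max (2 * M₁) (M₁ + |C₁|) with hM₂def
  have hM₂a : 2 * M₁ ≤ M₂ := le_max_left _ _
  have hM₂b : M₁ + |C₁| ≤ M₂ := le_max_right _ _
  have hM₂ : 1 ≤ M₂ := by linarith
  obtain ⟨M₃, hre⟩ := exists_re_esymm_bound n C M₂ hC hM₂
  set M := max (max M₂ M₃) (n * C) with hMdef
  have hM2 : M₂ ≤ M := (le_max_left _ _).trans (le_max_left _ _)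
  have hM3 : M₃ ≤ M := (le_max_right _ _).trans (le_max_left _ _)
  have hMC : n * C ≤ M := le_max_right _ _
  have hM : 1 ≤ M := hM₂.trans hM2
  obtain ⟨C₂, hlin⟩ := linear_constraint hn M hM
  refine ⟨(1 + C ^ 2 + 2 * M + 1.4 * |C₂|) / 2, by positivity, δ, hδ, ?_⟩
  intro β ε r P hε hεδ hβ hr hP hPn hroots hroot hcrit
  have hε1 : ε ≤ 1 := hεδ.trans hδ1
  have hn3 : (3 : ℝ) ≤ n := by exact_mod_cast hn
  set s := P.derivative.roots with hs
  have hcard : s.card = n - 1 := by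
    rw [hs, ← (IsAlgClosed.splits P.derivative).natDegree_eq_card_roots,
      Polynomial.natDegree_derivative, hPn]
  have hn1' : ((n - 1 : ℕ) : ℝ) = (n : ℝ) - 1 := by
    rw [Nat.cast_sub (by omega)]; simp
  have hcn : s.card ≤ n := by omega
  have hbd : ∀ z ∈ s, |z.re| ≤ C * ε ∧ z.im ^ 2 ≤ C * ε := by
    intro z hz
    obtain ⟨h1, h2⟩ := hloc β ε r P hε hεδ hβ (by linarith) hP hPn hroots hroot hcrit z hz
    have : C₀ * ε ≤ C * ε := mul_le_mul_of_nonneg_right (le_max_right _ _) hε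
    exact ⟨h1.trans this, h2.trans this⟩
  obtain ⟨hA, hek⟩ := hes s ε hcn hε hε1 hbd
  have he0 : s.esymm 0 = 1 := s.esymm_zero_right
  have he1 : s.esymm 1 = s.sum := s.esymm_one_eq_sum
  have hsq2 : √ε ^ 2 = ε := Real.sq_sqrt hε
  have hsq4 : √ε ^ 4 = ε ^ 2 := by rw [show 4 = 2 * 2 by norm_num, pow_mul, hsq2]
  have hR : RadialCondition n s.esymm β := by
    intro w hw hwn
    have h1 := re_mul_derivative_mul_conj_nonneg hroots hw
    rwa [mul_eval_derivative_eq_sum_esymm (by omega) hP hPn, eval_eq_sum_esymm hP hPn hroot] at h1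
  have hT : |s.sum.im| ≤ |C₁| * ε := by
    have h1 := him s.esymm ε β he0 hε hε1 hβ (by rwa [he1])
      (fun k hk hkn => by simpa using hek 1 k hk hkn.le)
      (fun k hk hkn => by simpa [hsq2] using hek 2 k hk hkn.le) hR
    rw [he1] at h1
    exact h1.trans (mul_le_mul_of_nonneg_right (le_abs_self _) hε)
  have hM₁ε : 0 ≤ M₁ * ε := by positivity
  have hC₁ε : 0 ≤ |C₁| * ε := by positivity
  have hM₂ε : M₁ * ε + |C₁| * ε ≤ M₂ * ε := by
    rw [← add_mul]; exact mul_le_mul_of_nonneg_right hM₂b hε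
  obtain ⟨hre2, hre3⟩ := hre s ε hcn hε hε1 hbd (by linarith) (by linarith)
  set Y := (s.map fun z => z.im ^ 2).sum / 2 with hY
  have hM2ε : M₂ * ε ≤ M * ε := mul_le_mul_of_nonneg_right hM2 hε
  have hM3ε : M₃ * ε ^ 2 ≤ M * ε ^ 2 := mul_le_mul_of_nonneg_right hM3 (by positivity)
  have hM2ε' : M₂ * ε ^ 2 ≤ M * ε ^ 2 := mul_le_mul_of_nonneg_right hM2 (by positivity)
  have hM1ε' : M₁ * ε ^ 2 ≤ M₂ * ε ^ 2 := mul_le_mul_of_nonneg_right (by linarith) (by positivity)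
  have hYsum : 0 ≤ (s.map fun z => z.im ^ 2).sum := Multiset.sum_nonneg (by
    intro x hx
    obtain ⟨z, -, rfl⟩ := Multiset.mem_map.1 hx
    positivity)
  have hY0 : 0 ≤ Y := by rw [hY]; linarith
  have hYM : Y ≤ M * ε := by
    have h1 := (le_abs_self _).trans (Multiset.abs_sum_map_le s (fun z => z.im ^ 2) (c := C * ε)
      fun z hz => by rw [abs_of_nonneg (sq_nonneg _)]; exact (hbd z hz).2)
    have h2 : (s.card : ℝ) * (C * ε) ≤ n * (C * ε) :=
      mul_le_mul_of_nonneg_right (by exact_mod_cast hcn) (by positivity)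
    have h3 : n * C * ε ≤ M * ε := mul_le_mul_of_nonneg_right hMC hε
    rw [hY]; linarith
  have hekM : ∀ k, 1 ≤ k → k < n → ‖s.esymm k‖ ≤ M * ε := by
    intro k hk hkn
    rcases hk.eq_or_lt with rfl | hk2
    · rw [he1]; linarith [Complex.norm_le_abs_re_add_abs_im s.sum]
    · have := hek 2 k hk2 hkn.le
      rw [hsq2] at this; linarith
  have hekR : ∀ k, 3 ≤ k → k < n → |(s.esymm k).re| ≤ M * ε ^ 2 := by
    intro k hk hkn
    rcases hk.eq_or_lt with rfl | hk4
    · linarith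
    · have := (Complex.abs_re_le_norm _).trans (hek 4 k hk4 hkn.le)
      rw [hsq4] at this; linarith
  have hnorm : ∀ w : ℂ, w ^ n = 1 → ‖w‖ = 1 := fun w hw =>
    Complex.norm_eq_one_of_pow_eq_one hw (by omega)
  have hcons := hlin s.esymm ε β Y he0 hε hε1 hβ hY0 hYM (by linarith) hekM hekR hR
  rw [he1] at hcons
  set A := s.sum.re with hAdef
  have hcomb := averaged_constraint hn hε hY0 fun w hw => hcons w (hnorm w hw) hw
  have h6 := averaged_dist_bound hn hcard (by linarith) (fun z hz => (hbd z hz).1) hcrit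
  rw [← hAdef, ← hY] at h6
  have hn1 : (0 : ℝ) < n - 1 := by linarith
  have h7 : |A / (n - 1)| ≤ M * ε := by
    rw [abs_div, abs_of_pos hn1]
    refine (div_le_self (abs_nonneg _) (by linarith)).trans ?_
    linarith
  have h8 : ε * (A / (n - 1)) ≤ M * ε ^ 2 := by
    have := mul_le_mul_of_nonneg_left ((le_abs_self _).trans h7) hε
    linarith
  have h9 : r ^ 2 ≤ 1 - 6 / 10 * ε + (1 + C ^ 2 + 2 * M + 1.4 * |C₂|) * ε ^ 2 := by
    rw [hβ] at h6
    linarith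
  -- From 2r - 1 ≤ r², so the constant for r is half of the one for r².
  nlinarith [sq_nonneg (r - 1)]

/-- The only critical point is the midpoint of β and the other root z, so the distance is |β - z|/2
≤ (1 + β)/2. -/
theorem dist_bound_two {β r : ℝ} {P : Polynomial ℂ} (hβ0 : 0 ≤ β) (hP : P.Monic)
    (hPn : P.natDegree = 2) (hroots : ∀ z : ℂ, P.IsRoot z → ‖z‖ ≤ 1) (hroot : P.IsRoot β)
    (hcrit : ∀ ζ ∈ P.derivative.roots, r ≤ ‖(β : ℂ) - ζ‖) : r ≤ 1 - (1 - β) / 2 := by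
  obtain ⟨Q, hQ⟩ := Polynomial.dvd_iff_isRoot.2 hroot
  have hQm : Q.Monic := (Polynomial.monic_X_sub_C _).of_mul_monic_left (hQ ▸ hP)
  have hQn : Q.natDegree = 1 := by
    have h := hPn
    rw [hQ, (Polynomial.monic_X_sub_C _).natDegree_mul hQm, Polynomial.natDegree_X_sub_C] at h
    omega
  have hcQ : Q.roots.card = 1 := by
    rw [← (IsAlgClosed.splits Q).natDegree_eq_card_roots, hQn]
  have hcP : P.derivative.roots.card = 1 := by
    rw [← (IsAlgClosed.splits P.derivative).natDegree_eq_card_roots,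
      Polynomial.natDegree_derivative, hPn]
  obtain ⟨z, hz⟩ := Multiset.card_eq_one.1 hcQ
  obtain ⟨ζ, hζ⟩ := Multiset.card_eq_one.1 hcP
  have hlc : P.derivative.leadingCoeff = 2 := by
    rw [Polynomial.leadingCoeff, Polynomial.natDegree_derivative, hPn, Polynomial.coeff_derivative]
    have := hP.coeff_natDegree
    rw [hPn] at this
    simp [this]; norm_num
  have heq : P.derivative.eval (β : ℂ) = Q.eval (β : ℂ) := by simp [hQ]
  have h1 := norm_eval_eq_prod_roots P.derivative β
  have h2 := norm_eval_eq_prod_roots Q β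
  rw [heq, h2, hz, hζ, hlc, hQm.leadingCoeff] at h1
  simp only [norm_one, one_mul, Multiset.map_singleton, Multiset.prod_singleton,
    Complex.norm_ofNat] at h1
  have hz1 : ‖z‖ ≤ 1 := by
    apply hroots
    have hzQ : Q.IsRoot z := (Polynomial.mem_roots hQm.ne_zero).1 (by rw [hz]; simp)
    rw [hQ, Polynomial.IsRoot.def, Polynomial.eval_mul, hzQ.eq_zero, mul_zero]
  have h3 := norm_sub_le (β : ℂ) z
  rw [Complex.norm_real, Real.norm_of_nonneg hβ0] at h3
  have h4 := hcrit ζ (by rw [hζ]; simp)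
  linarith

theorem critDist_le_norm_sub {P : Polynomial ℂ} {b ζ : ℂ} (hζ : P.derivative.IsRoot ζ) :
    critDist P b ≤ ‖b - ζ‖ := by
  rw [← dist_eq_norm]; exact Metric.infDist_le_dist_of_mem hζ

/-- Bounds for monic polynomials transfer to the Sendov radius. -/
theorem sendovRadius_le {n : ℕ} (hn : 2 ≤ n) {b : ℂ} (hb : ‖b‖ ≤ 1) {B : ℝ}
    (h : ∀ (P : Polynomial ℂ) (r : ℝ), P.Monic → P.natDegree = n →
      (∀ z : ℂ, P.IsRoot z → ‖z‖ ≤ 1) → P.IsRoot b →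
      (∀ ζ ∈ P.derivative.roots, r ≤ ‖b - ζ‖) → r ≤ B) : sendovRadius n b ≤ B := by
  refine (sendovRadius_isLUB n hn b hb).2 ?_
  rintro _ ⟨P, ⟨hd, hr, hroot⟩, rfl⟩
  have hnd : P.natDegree = n := Polynomial.natDegree_eq_of_degree_eq_some hd
  have hP0 : P ≠ 0 := by
    rintro rfl
    simp at hnd
    omega
  have hlc : P.leadingCoeff⁻¹ ≠ 0 := inv_ne_zero (Polynomial.leadingCoeff_ne_zero.2 hP0)
  have hiff : ∀ (R : Polynomial ℂ) z, (R * Polynomial.C P.leadingCoeff⁻¹).IsRoot z → R.IsRoot z := by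
    intro R z hz
    rw [Polynomial.IsRoot.def, Polynomial.eval_mul, Polynomial.eval_C] at hz
    exact (mul_eq_zero.1 hz).resolve_right hlc
  refine h (P * Polynomial.C P.leadingCoeff⁻¹) _ (Polynomial.monic_mul_leadingCoeff_inv hP0) ?_
    (fun z hz => hr z (hiff P z hz)) ?_ ?_
  · rw [Polynomial.natDegree_mul_C hlc, hnd]
  · rw [Polynomial.IsRoot.def, Polynomial.eval_mul, hroot.eq_zero, zero_mul]
  · intro ζ hζ
    apply critDist_le_norm_sub
    apply hiff
    have := Polynomial.isRoot_of_mem_roots hζ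
    rwa [Polynomial.derivative_mul, Polynomial.derivative_C, mul_zero, add_zero] at this

theorem eventually_nhdsLE_one {δ : ℝ} (hδ : 0 < δ) : ∀ᶠ β : ℝ in 𝓝[≤] 1, 0 ≤ 1 - β ∧ 1 - β ≤ δ := by
  have h1 : ∀ᶠ β : ℝ in 𝓝[≤] 1, 1 - δ < β :=
    nhdsWithin_le_nhds (lt_mem_nhds (by linarith))
  filter_upwards [h1, self_mem_nhdsWithin] with β h2 h3
  have h3' : β ≤ 1 := h3
  constructor <;> linarith

theorem norm_ofReal_le_one {β : ℝ} (h0 : 0 ≤ 1 - β) (h1 : 1 - β ≤ 1) : ‖(β : ℂ)‖ ≤ 1 := by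
  rw [Complex.norm_real, Real.norm_of_nonneg (by linarith)]; linarith

theorem sendovRadius_upper {n : ℕ} (hn : 2 ≤ n) : ∃ C : ℝ, ∀ᶠ β : ℝ in 𝓝[≤] 1,
    sendovRadius n (β : ℂ) ≤ 1 - 3 / 10 * (1 - β) + C * (1 - β) ^ 2 := by
  rcases hn.eq_or_lt with rfl | hn3
  · refine ⟨0, ?_⟩
    filter_upwards [eventually_nhdsLE_one one_pos] with β ⟨h0, h1⟩
    refine sendovRadius_le hn (norm_ofReal_le_one h0 h1) fun P r hP hPn hr hroot hcrit => ?_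
    have := dist_bound_two (by linarith) hP hPn hr hroot hcrit
    linarith
  · obtain ⟨K, hK, δ, hδ, h⟩ := exists_dist_bound (n := n) hn3
    refine ⟨K, ?_⟩
    filter_upwards [eventually_nhdsLE_one one_pos, eventually_nhdsLE_one hδ] with β ⟨h0, h1⟩ ⟨_, h2⟩
    refine sendovRadius_le hn (norm_ofReal_le_one h0 h1) fun P r hP hPn hr hroot hcrit => ?_
    rcases le_total (1 - 3 / 10 * (1 - β)) r with h3 | h3
    · exact h β (1 - β) r P h0 h2 (by ring) h3 hP hPn hr hroot hcrit
    · have : 0 ≤ K * (1 - β) ^ 2 := by positivity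
      linarith

/-! ### The extremal quintic -/

theorem norm_eq_one_of_palindromic_quadratic {s : ℝ} (hs : s ^ 2 ≤ 4) {z : ℂ}
    (hz : z ^ 2 + s * z + 1 = 0) : ‖z‖ = 1 := by
  have hre := congrArg Complex.re hz
  have him := congrArg Complex.im hz
  simp only [pow_two, Complex.add_re, Complex.mul_re, Complex.ofReal_re, Complex.ofReal_im,
    Complex.one_re, Complex.zero_re, Complex.add_im, Complex.mul_im, Complex.one_im,
    Complex.zero_im] at hre him
  have h : z.re ^ 2 + z.im ^ 2 = 1 := by
    have h1 : z.im * (2 * z.re + s) = 0 := by linarith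
    rcases mul_eq_zero.1 h1 with h2 | h2
    · rw [h2] at hre ⊢
      have h3 : (z.re + s / 2) ^ 2 = 0 := by
        apply le_antisymm _ (sq_nonneg _)
        nlinarith
      have h4 : z.re = -(s / 2) := by linarith [pow_eq_zero_iff (two_ne_zero) |>.1 h3]
      rw [h4] at hre ⊢
      nlinarith
    · have h4 : s = -2 * z.re := by linarith
      rw [h4] at hre
      nlinarith
  rw [← sq_eq_sq₀ (norm_nonneg _) one_pos.le, ← Complex.normSq_eq_norm_sq, Complex.normSq_apply]
  linarith

open Polynomial in
/-- The quintic with root `1 - ε` and four unimodular roots that is extremal to first order. -/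
noncomputable def extremalQuintic (ε : ℝ) : ℂ[X] :=
  -- The coefficient -6/5 only affects P' beyond its leading rescaled form; it is tuned so that both
  -- pairs of critical points have the same distance from 1 - ε to first order.
  (X - C ((1 - ε : ℝ) : ℂ)) * (X ^ 4 + C ((1 + ε : ℝ) : ℂ) * X ^ 3 +
    C ((1 + 2 * ε - 6 / 5 * ε ^ 2 : ℝ) : ℂ) * X ^ 2 + C ((1 + ε : ℝ) : ℂ) * X + 1)

open Polynomial in
theorem extremalQuintic_mem {ε : ℝ} (hε : 0 ≤ ε) (hε1 : ε ≤ 1 / 10) :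
    extremalQuintic ε ∈ SendovClass 5 ((1 - ε : ℝ) : ℂ) := by
  refine ⟨?_, ?_, ?_⟩
  · rw [extremalQuintic, degree_mul, degree_X_sub_C]
    have : degree (X ^ 4 + C ((1 + ε : ℝ) : ℂ) * X ^ 3 +
        C ((1 + 2 * ε - 6 / 5 * ε ^ 2 : ℝ) : ℂ) * X ^ 2 + C ((1 + ε : ℝ) : ℂ) * X + 1 : ℂ[X]) = 4 := by
      compute_degree!
    rw [this]; rfl
  · intro z hz
    rw [IsRoot.def, extremalQuintic, eval_mul, mul_eq_zero] at hz
    rcases hz with hz | hz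
    · rw [eval_sub, eval_X, eval_C, sub_eq_zero] at hz
      rw [hz, Complex.norm_real, Real.norm_of_nonneg (by linarith)]; linarith
    · simp only [eval_add, eval_mul, eval_pow, eval_X, eval_C, eval_one] at hz
      -- The palindromic quartic splits as (z² + s₁z + 1)(z² + s₂z + 1), where s₁, s₂ have sum 1 + ε
      -- and discriminant D.
      set D : ℝ := 5 - 6 * ε + 29 / 5 * ε ^ 2 with hD
      have hD0 : 0 ≤ D := by rw [hD]; nlinarith
      have hsq : √D ^ 2 = D := Real.sq_sqrt hD0
      have hs0 := Real.sqrt_nonneg D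
      have hs1 : √D ≤ 2.5 := by
        rw [Real.sqrt_le_iff]; constructor <;> [norm_num; nlinarith]
      have hsum : (((1 + ε + √D) / 2 : ℝ) : ℂ) + (((1 + ε - √D) / 2 : ℝ) : ℂ) =
          ((1 + ε : ℝ) : ℂ) := by
        rw [← Complex.ofReal_add]; congr 1; ring
      have hprod : (((1 + ε + √D) / 2 : ℝ) : ℂ) * (((1 + ε - √D) / 2 : ℝ) : ℂ) + 2 =
          ((1 + 2 * ε - 6 / 5 * ε ^ 2 : ℝ) : ℂ) := by
        rw [← Complex.ofReal_mul, ← Complex.ofReal_ofNat, ← Complex.ofReal_add]; congr 1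
        linear_combination -(1 / 4) * hsq - (1 / 4) * hD
      have hfac : (z ^ 2 + (((1 + ε + √D) / 2 : ℝ) : ℂ) * z + 1) *
          (z ^ 2 + (((1 + ε - √D) / 2 : ℝ) : ℂ) * z + 1) = 0 := by
        rw [← hz, ← hsum, ← hprod]; ring
      rcases mul_eq_zero.1 hfac with h | h
      · exact (norm_eq_one_of_palindromic_quadratic (by nlinarith) h).le
      · exact (norm_eq_one_of_palindromic_quadratic (by nlinarith) h).le
  · simp [extremalQuintic]

open Polynomial in
theorem eval_derivative_extremalQuintic (ε : ℝ) (z : ℂ) :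
    (extremalQuintic ε).derivative.eval z = 5 * z ^ 4 + 8 * ε * z ^ 3 +
      (6 * ε - 3 / 5 * ε ^ 2) * z ^ 2 + (32 / 5 * ε ^ 2 - 12 / 5 * ε ^ 3) * z + ε ^ 2 := by
  rw [extremalQuintic]
  have ha : ((1 - ε : ℝ) : ℂ) = 1 - ε := by push_cast; ring
  have hb : ((1 + ε : ℝ) : ℂ) = 1 + ε := by push_cast; ring
  have hc : ((1 + 2 * ε - 6 / 5 * ε ^ 2 : ℝ) : ℂ) = 1 + 2 * ε - 6 / 5 * ε ^ 2 := by
    push_cast; ring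
  generalize ((1 - ε : ℝ) : ℂ) = a at *
  generalize ((1 + ε : ℝ) : ℂ) = b at *
  generalize ((1 + 2 * ε - 6 / 5 * ε ^ 2 : ℝ) : ℂ) = c at *
  simp only [derivative_mul, derivative_add, derivative_sub, derivative_X, derivative_C,
    derivative_X_pow, derivative_one, eval_add, eval_mul, eval_sub, eval_pow, eval_X, eval_C,
    eval_one, eval_zero]
  subst ha hb hc
  push_cast
  ring

/-- Localization of the rescaled critical points. -/
theorem rescaled_criticalPoint_localization {η : ℝ} (hη : 0 < η) (hη1 : η ≤ 1 / 1000) {Z : ℂ}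
    (hZ : 5 * Z ^ 4 + 8 * η * Z ^ 3 + (6 - 3 / 5 * η ^ 2) * Z ^ 2 +
      (32 / 5 * η - 12 / 5 * η ^ 3) * Z + 1 = 0) :
    |Z.re| ≤ 75 * η ∧ |Z.im| ≤ 2 ∧ (Z.im ^ 2 ≤ 2 / 5 ∨ 9 / 10 ≤ Z.im ^ 2) ∧ Z.im ≠ 0 := by
  have hnorms : ‖8 * η * Z ^ 3 - 3 / 5 * η ^ 2 * Z ^ 2 + (32 / 5 * η - 12 / 5 * η ^ 3) * Z‖ ≤
      8 * η * ‖Z‖ ^ 3 + η * ‖Z‖ ^ 2 + 10 * η * ‖Z‖ := by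
    have e1 : ‖8 * (η : ℂ) * Z ^ 3‖ = 8 * η * ‖Z‖ ^ 3 := by
      rw [norm_mul, norm_mul, norm_pow, Complex.norm_real, Real.norm_of_nonneg hη.le]; simp
    have e2 : ‖3 / 5 * (η : ℂ) ^ 2 * Z ^ 2‖ ≤ η * ‖Z‖ ^ 2 := by
      rw [norm_mul, norm_mul, norm_pow, norm_pow, Complex.norm_real, Real.norm_of_nonneg hη.le]
      refine mul_le_mul_of_nonneg_right ?_ (by positivity)
      have : ‖(3 / 5 : ℂ)‖ = 3 / 5 := by simp
      rw [this]; nlinarith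
    have e3 : ‖(32 / 5 * (η : ℂ) - 12 / 5 * η ^ 3) * Z‖ ≤ 10 * η * ‖Z‖ := by
      rw [norm_mul]
      refine mul_le_mul_of_nonneg_right ?_ (norm_nonneg _)
      have : (32 / 5 * (η : ℂ) - 12 / 5 * η ^ 3) = ((32 / 5 * η - 12 / 5 * η ^ 3 : ℝ) : ℂ) := by
        push_cast; ring
      have h3 : η ^ 3 ≤ η := by nlinarith [pow_pos hη 2, pow_pos hη 3]
      rw [this, Complex.norm_real, Real.norm_eq_abs, abs_le]
      constructor <;> nlinarith [pow_pos hη 3]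
    calc _ ≤ ‖8 * (η : ℂ) * Z ^ 3‖ + ‖3 / 5 * (η : ℂ) ^ 2 * Z ^ 2‖ +
          ‖(32 / 5 * (η : ℂ) - 12 / 5 * η ^ 3) * Z‖ :=
          (norm_add_le _ _).trans (add_le_add_left (norm_sub_le _ _) _)
      _ ≤ _ := by linarith
  have hR : ‖Z‖ ≤ 2 := by
    by_contra hc
    push Not at hc
    have e1 : 5 * Z ^ 4 = -(8 * η * Z ^ 3 - 3 / 5 * η ^ 2 * Z ^ 2 +
        (32 / 5 * η - 12 / 5 * η ^ 3) * Z) - 6 * Z ^ 2 - 1 := by linear_combination hZ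
    have e2 : ‖5 * Z ^ 4‖ ≤ ‖8 * η * Z ^ 3 - 3 / 5 * η ^ 2 * Z ^ 2 +
        (32 / 5 * η - 12 / 5 * η ^ 3) * Z‖ + 6 * ‖Z‖ ^ 2 + 1 := by
      rw [e1]
      refine (norm_sub_le _ _).trans ?_
      rw [norm_one]
      refine add_le_add_left ((norm_sub_le _ _).trans ?_) _
      rw [norm_neg, norm_mul, norm_pow]; simp
    have e3 : ‖5 * Z ^ 4‖ = 5 * ‖Z‖ ^ 4 := by rw [norm_mul, norm_pow]; simp
    rw [e3] at e2
    set ρ := ‖Z‖ with hρ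
    have e4 : 5 * ρ ^ 4 ≤ ρ ^ 3 + 7 * ρ ^ 2 + ρ + 1 := by
      have f1 : 8 * η * ρ ^ 3 ≤ ρ ^ 3 := by
        have : 0 ≤ ρ ^ 3 := by positivity
        nlinarith
      have f2 : η * ρ ^ 2 ≤ ρ ^ 2 := by
        have : 0 ≤ ρ ^ 2 := by positivity
        nlinarith
      have f3 : 10 * η * ρ ≤ ρ := by nlinarith
      linarith
    have f1 : 2 * ρ ^ 3 ≤ ρ ^ 4 := by
      have : 0 ≤ ρ ^ 3 := by positivity
      nlinarith
    have f2 : 2 * ρ ^ 2 ≤ ρ ^ 3 := by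
      have : 0 ≤ ρ ^ 2 := by positivity
      nlinarith
    nlinarith
  -- At η = 0 the equation is (5Z² + 1)(Z² + 1) = 0. The two factors cannot both be small, because
  -- 5(Z² + 1) - (5Z² + 1) = 4; so Z² is within O(η) of -1/5 or of -1.
  have hprod : ‖5 * Z ^ 2 + 1‖ * ‖Z ^ 2 + 1‖ ≤ 90 * η := by
    rw [← norm_mul]
    have e1 : (5 * Z ^ 2 + 1) * (Z ^ 2 + 1) = -(8 * η * Z ^ 3 - 3 / 5 * η ^ 2 * Z ^ 2 +
        (32 / 5 * η - 12 / 5 * η ^ 3) * Z) := by linear_combination hZ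
    rw [e1, norm_neg]
    refine hnorms.trans ?_
    have f1 : ‖Z‖ ^ 3 ≤ 2 ^ 3 := pow_le_pow_left₀ (norm_nonneg _) hR 3
    have f2 : ‖Z‖ ^ 2 ≤ 2 ^ 2 := pow_le_pow_left₀ (norm_nonneg _) hR 2
    nlinarith
  have hy2 : |Z.im| ≤ 2 := (Complex.abs_im_le_norm _).trans hR
  have hsq : (Z ^ 2).re = Z.re ^ 2 - Z.im ^ 2 ∧ (Z ^ 2).im = 2 * Z.re * Z.im := by
    rw [pow_two, Complex.mul_re, Complex.mul_im]; constructor <;> ring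
  have hXfin : ∀ d : ℝ, 1 / 10 ≤ Z.im ^ 2 → |2 * Z.re * Z.im| ≤ d → |Z.re| ≤ 5 / 3 * d := by
    intro d h1 h2
    rw [abs_mul, abs_mul, abs_two] at h2
    have h3 : 3 / 10 ≤ |Z.im| := by
      by_contra hc
      push Not at hc
      have := pow_lt_pow_left₀ hc (abs_nonneg _) (two_ne_zero)
      rw [sq_abs] at this
      linarith
    nlinarith [abs_nonneg Z.re]
  rcases le_or_gt (2 / 5) ‖Z ^ 2 + 1‖ with h | h
  · have h1 : ‖5 * Z ^ 2 + 1‖ ≤ 225 * η := by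
      nlinarith [norm_nonneg (5 * Z ^ 2 + 1)]
    have h2 := (Complex.abs_re_le_norm _).trans h1
    have h3 := (Complex.abs_im_le_norm _).trans h1
    have r1 : (5 * Z ^ 2 + 1).re = 5 * (Z.re ^ 2 - Z.im ^ 2) + 1 := by rw [← hsq.1]; simp
    have r2 : (5 * Z ^ 2 + 1).im = 5 * (2 * Z.re * Z.im) := by rw [← hsq.2]; simp
    rw [r1, abs_le] at h2
    rw [r2, abs_mul, abs_of_pos (by norm_num : (0 : ℝ) < 5)] at h3
    have h4 : 1 / 10 ≤ Z.im ^ 2 := by nlinarith [sq_nonneg Z.re]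
    have h5 := hXfin (45 * η) h4 (by linarith)
    have h6 : |Z.re| ≤ 75 * η := by linarith
    refine ⟨h6, hy2, Or.inl ?_, by rintro h0; rw [h0] at h4; norm_num at h4⟩
    have h7 : Z.re ^ 2 ≤ (75 / 1000) ^ 2 := by
      rw [← sq_abs]; exact pow_le_pow_left₀ (abs_nonneg _) (by linarith) 2
    nlinarith
  · have h0 : 2 ≤ ‖5 * Z ^ 2 + 1‖ := by
      have e : (4 : ℂ) = 5 * (Z ^ 2 + 1) - (5 * Z ^ 2 + 1) := by ring
      have e2 : ‖(4 : ℂ)‖ ≤ ‖5 * (Z ^ 2 + 1)‖ + ‖5 * Z ^ 2 + 1‖ := by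
        conv_lhs => rw [e]
        exact norm_sub_le _ _
      rw [norm_mul] at e2
      have e3 : ‖(4 : ℂ)‖ = 4 := by simp
      have e4 : ‖(5 : ℂ)‖ = 5 := by simp
      rw [e3, e4] at e2
      linarith
    have h1 : ‖Z ^ 2 + 1‖ ≤ 45 * η := by
      nlinarith [norm_nonneg (Z ^ 2 + 1)]
    have h2 := (Complex.abs_re_le_norm _).trans h1
    have h3 := (Complex.abs_im_le_norm _).trans h1
    have r1 : (Z ^ 2 + 1).re = Z.re ^ 2 - Z.im ^ 2 + 1 := by rw [← hsq.1]; simp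
    have r2 : (Z ^ 2 + 1).im = 2 * Z.re * Z.im := by rw [← hsq.2]; simp
    rw [r1, abs_le] at h2
    rw [r2] at h3
    have h4 : 9 / 10 ≤ Z.im ^ 2 := by nlinarith [sq_nonneg Z.re]
    have h5 : |Z.re| ≤ 75 * η := by
      have h6 : 9 / 10 ≤ |Z.im| := by
        by_contra hc
        push Not at hc
        have := pow_lt_pow_left₀ hc (abs_nonneg _) (two_ne_zero)
        rw [sq_abs] at this
        linarith
      rw [abs_mul, abs_mul, abs_two] at h3
      nlinarith [abs_nonneg Z.re]
    exact ⟨h5, hy2, Or.inr h4, by rintro h0; rw [h0] at h4; norm_num at h4⟩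

/-- These are the higher order terms left after setting Z = ηx + iy and ε = η²; compactness makes
the constant uniform. -/
theorem exists_remainder_bound : ∃ K : ℝ, 0 ≤ K ∧ ∀ x y ε : ℝ, 0 ≤ ε → ε ≤ 1 → |x| ≤ 75 → |y| ≤ 2 →
    |ε * (20 * x ^ 3 + 24 * x ^ 2 - 6 / 5 * x - 12 / 5)| ≤ K * ε ∧
    |ε * (5 * (ε * x ^ 4 - 6 * x ^ 2 * y ^ 2) + 8 * (ε * x ^ 3 - 3 * x * y ^ 2) +
      6 * x ^ 2 - 3 / 5 * (ε * x ^ 2 - y ^ 2) + (32 / 5 - 12 / 5 * ε) * x)| ≤ K * ε := by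
  have hcpt : IsCompact (Set.Icc (-75 : ℝ) 75 ×ˢ Set.Icc (-2 : ℝ) 2 ×ˢ Set.Icc (0 : ℝ) 1) :=
    isCompact_Icc.prod (isCompact_Icc.prod isCompact_Icc)
  obtain ⟨K₁, h₁⟩ := hcpt.exists_bound_of_continuousOn
    (f := fun q : ℝ × ℝ × ℝ => 20 * q.1 ^ 3 + 24 * q.1 ^ 2 - 6 / 5 * q.1 - 12 / 5)
    (by fun_prop)
  obtain ⟨K₂, h₂⟩ := hcpt.exists_bound_of_continuousOn
    (f := fun q : ℝ × ℝ × ℝ => 5 * (q.2.2 * q.1 ^ 4 - 6 * q.1 ^ 2 * q.2.1 ^ 2) +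
      8 * (q.2.2 * q.1 ^ 3 - 3 * q.1 * q.2.1 ^ 2) + 6 * q.1 ^ 2 -
      3 / 5 * (q.2.2 * q.1 ^ 2 - q.2.1 ^ 2) + (32 / 5 - 12 / 5 * q.2.2) * q.1)
    (by fun_prop)
  refine ⟨max 0 (max K₁ K₂), le_max_left _ _, fun x y ε h0 h1 hx hy => ?_⟩
  have hmem : (x, y, ε) ∈ Set.Icc (-75 : ℝ) 75 ×ˢ Set.Icc (-2 : ℝ) 2 ×ˢ Set.Icc (0 : ℝ) 1 :=
    ⟨abs_le.1 hx, abs_le.1 hy, h0, h1⟩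
  rw [abs_mul, abs_mul, abs_of_nonneg h0, mul_comm ε, mul_comm ε]
  exact ⟨mul_le_mul_of_nonneg_right
      ((h₁ _ hmem).trans ((le_max_left _ _).trans (le_max_right _ _))) h0,
    mul_le_mul_of_nonneg_right
      ((h₂ _ hmem).trans ((le_max_right _ _).trans (le_max_right _ _))) h0⟩

/-- Without errors, y² = 1/5 forces x = -3/5 and y² = 1 forces x = -1/5. In both cases -2x + y² =
7/5. -/
theorem le_of_perturbed_equations {x y B E₁ E₂ : ℝ} (hB : 0 ≤ B) (hx : |x| ≤ 75) (h₁ : |E₁| ≤ B)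
    (h₂ : |E₂| ≤ B) (hcase : y ^ 2 ≤ 2 / 5 ∨ 9 / 10 ≤ y ^ 2)
    (him : x * (12 - 20 * y ^ 2) - 8 * y ^ 2 + 32 / 5 + E₁ = 0)
    (hre : (5 * y ^ 2 - 1) * (y ^ 2 - 1) + E₂ = 0) :
    7 / 5 - 1000 * B ≤ -2 * x + y ^ 2 := by
  generalize y ^ 2 = w at *
  rw [abs_le] at h₁
  have aux : ∀ t u : ℝ, t * u = -E₂ → 1 / 2 ≤ |u| → |t| ≤ 2 * B ∧ |t * x| ≤ 150 * B := by
    intro t u htu hu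
    have h1 : |t| * |u| ≤ B := by rw [← abs_mul, htu, abs_neg]; exact h₂
    have h3 : |t| * (1 / 2) ≤ |t| * |u| := mul_le_mul_of_nonneg_left hu (abs_nonneg t)
    have h4 : |t| ≤ 2 * B := by linarith
    refine ⟨h4, ?_⟩
    rw [abs_mul]
    have := mul_le_mul h4 hx (abs_nonneg _) (by positivity)
    linarith
  rcases hcase with h | h
  · obtain ⟨a, b⟩ := aux (5 * w - 1) (w - 1) (by linarith) (by
      rw [abs_of_neg (by linarith)]; linarith)
    rw [abs_le] at a b
    linarith [a.1, a.2, b.1, b.2, h₁.1, h₁.2]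
  · obtain ⟨a, b⟩ := aux (w - 1) (5 * w - 1) (by linarith) (by
      rw [abs_of_pos (by linarith)]; linarith)
    rw [abs_le] at a b
    linarith [a.1, a.2, b.1, b.2, h₁.1, h₁.2]

/-- Refined position of the rescaled critical points. -/
theorem exists_rescaled_criticalPoint_bound : ∃ K : ℝ, 0 ≤ K ∧ ∀ (η : ℝ) (Z : ℂ), 0 < η →
    η ≤ 1 / 1000 → 5 * Z ^ 4 + 8 * η * Z ^ 3 + (6 - 3 / 5 * η ^ 2) * Z ^ 2 +
      (32 / 5 * η - 12 / 5 * η ^ 3) * Z + 1 = 0 →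
    ∃ x : ℝ, Z.re = η * x ∧ |x| ≤ 75 ∧ 7 / 5 - K * η ^ 2 ≤ -2 * x + Z.im ^ 2 := by
  obtain ⟨K, hK, hrem⟩ := exists_remainder_bound
  refine ⟨1000 * K, by positivity, ?_⟩
  intro η Z hη hη1 hZ
  obtain ⟨hX, hy, hcase, hy0⟩ := rescaled_criticalPoint_localization hη hη1 hZ
  set y := Z.im with hydef
  set x := Z.re / η with hxdef
  have hXx : Z.re = η * x := by rw [hxdef]; field_simp
  have hx : |x| ≤ 75 := by
    rw [hxdef, abs_div, abs_of_pos hη, div_le_iff₀ hη]; exact hX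
  refine ⟨x, hXx, hx, ?_⟩
  have hZxy : Z = ((η * x : ℝ) : ℂ) + (y : ℂ) * Complex.I := by
    rw [← hXx, hydef, Complex.re_add_im]
  have hexp : ((5 * ((η * x) ^ 4 - 6 * (η * x) ^ 2 * y ^ 2 + y ^ 4) +
        8 * η * ((η * x) ^ 3 - 3 * (η * x) * y ^ 2) +
        (6 - 3 / 5 * η ^ 2) * ((η * x) ^ 2 - y ^ 2) +
        (32 / 5 * η - 12 / 5 * η ^ 3) * (η * x) + 1 : ℝ) : ℂ) +
      ((y * (5 * (4 * (η * x) ^ 3 - 4 * (η * x) * y ^ 2) + 8 * η * (3 * (η * x) ^ 2 - y ^ 2) +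
        (6 - 3 / 5 * η ^ 2) * (2 * (η * x)) + (32 / 5 * η - 12 / 5 * η ^ 3)) : ℝ) : ℂ) *
        Complex.I = 0 := by
    rw [hZxy] at hZ
    rw [← hZ]
    push_cast
    ring_nf
    simp only [show Complex.I ^ 4 = 1 from Complex.I_pow_four,
      show Complex.I ^ 3 = -Complex.I from Complex.I_pow_three, Complex.I_sq]
    ring
  have hre := congrArg Complex.re hexp
  have him := congrArg Complex.im hexp
  rw [Complex.add_re, Complex.re_ofReal_mul, Complex.I_re, mul_zero, add_zero, Complex.ofReal_re,
    Complex.zero_re] at hre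
  rw [Complex.add_im, Complex.im_ofReal_mul, Complex.I_im, mul_one, Complex.ofReal_im, zero_add,
    Complex.zero_im] at him
  have him2 := (mul_eq_zero.1 him).resolve_left hy0
  have hε1 : η ^ 2 ≤ 1 := by nlinarith
  obtain ⟨b1, b2⟩ := hrem x y (η ^ 2) (by positivity) hε1 hx hy
  rw [mul_assoc]
  -- The imaginary part was divided by y; a further factor η comes out before the equation has the
  -- required form.
  refine le_of_perturbed_equations (by positivity) hx b1 b2 hcase ?_ ?_
  · refine (mul_eq_zero.1 (?_ : η * _ = 0)).resolve_left hη.ne'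
    rw [← him2]; ring
  · rw [← hre]; ring

/-- With z = √ε Z, Re z = εx and (Im z)² = εy², the squared distance is 1 - 2ε + ε(-2x + y²) up to
O(ε²), and -2 + 7/5 = -6/10. -/
theorem norm_sub_extremalQuintic_criticalPoint : ∃ K : ℝ, 0 ≤ K ∧ ∀ (ε : ℝ) (z : ℂ), 0 < ε →
    ε ≤ 1 / 1000000 → (extremalQuintic ε).derivative.IsRoot z →
    1 - 6 / 10 * ε - K * ε ^ 2 ≤ ‖((1 - ε : ℝ) : ℂ) - z‖ ^ 2 := by
  obtain ⟨K, hK, h⟩ := exists_rescaled_criticalPoint_bound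
  refine ⟨K + 150, by positivity, ?_⟩
  intro ε z hε hε1 hz
  rw [Polynomial.IsRoot.def, eval_derivative_extremalQuintic] at hz
  set η := √ε with hη
  have hη0 : 0 < η := Real.sqrt_pos.2 hε
  have hηε : ε = η ^ 2 := (Real.sq_sqrt hε.le).symm
  have hη1 : η ≤ 1 / 1000 := by
    rw [hη, Real.sqrt_le_iff]; constructor <;> [norm_num; (norm_num; linarith)]
  have hηc : (η : ℂ) ≠ 0 := by exact_mod_cast hη0.ne'
  obtain ⟨x, hx1, hx2, hx3⟩ := h η (z / η) hη0 hη1 (by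
    rw [hηε] at hz
    push_cast at hz
    field_simp
    linear_combination 5 * hz)
  rw [Complex.div_ofReal_re] at hx1
  rw [Complex.div_ofReal_im] at hx3
  have hre : z.re = ε * x := by
    rw [div_eq_iff hη0.ne'] at hx1
    rw [hx1, hηε]; ring
  have him : z.im ^ 2 = ε * (z.im / η) ^ 2 := by
    rw [hηε]; field_simp
  rw [← hηε] at hx3
  rw [← Complex.normSq_eq_norm_sq, Complex.normSq_apply]
  simp only [Complex.sub_re, Complex.sub_im, Complex.ofReal_re, Complex.ofReal_im]
  rw [abs_le] at hx2
  have h1 := mul_le_mul_of_nonneg_left hx3 hε.le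
  have h2 : -75 * ε ^ 2 ≤ x * ε ^ 2 := mul_le_mul_of_nonneg_right hx2.1 (by positivity)
  have h3 : (1 - ε - z.re) * (1 - ε - z.re) + (0 - z.im) * (0 - z.im) =
      1 - 2 * ε + ε ^ 2 + z.re ^ 2 + ε * (-2 * x + (z.im / η) ^ 2) + 2 * (x * ε ^ 2) := by
    linear_combination him + (-2 + 2 * ε) * hre
  rw [h3]
  linarith [sq_nonneg ε, sq_nonneg z.re]

/-- Needed because `Metric.infDist` to the empty set is 0, so a lower bound requires a critical
point. -/
theorem exists_derivative_extremalQuintic_root (ε : ℝ) :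
    {ζ : ℂ | (extremalQuintic ε).derivative.IsRoot ζ}.Nonempty := by
  by_contra hc
  rw [Set.not_nonempty_iff_eq_empty] at hc
  have hdeg : 0 < (extremalQuintic ε).derivative.degree := by
    by_contra hd
    obtain ⟨c, hceq⟩ : ∃ c, (extremalQuintic ε).derivative = Polynomial.C c :=
      ⟨_, Polynomial.eq_C_of_degree_le_zero (not_lt.1 hd)⟩
    have h := fun z => eval_derivative_extremalQuintic ε z
    simp only [hceq, Polynomial.eval_C] at h
    have h0 := h 0
    have h1 := h 1
    have h2 := h (-1)
    have h3 := h 2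
    have h4 := h (-2)
    -- The fourth difference of a constant vanishes, while that of 5z⁴ + ⋯ is 5 · 4!.
    have : (120 : ℂ) = 0 := by
      linear_combination 4 * h1 + 4 * h2 - h3 - h4 - 6 * h0
    norm_num at this
  obtain ⟨ζ, hζ⟩ := Complex.exists_root hdeg
  have : ζ ∈ ({ζ : ℂ | (extremalQuintic ε).derivative.IsRoot ζ} : Set ℂ) := hζ
  rw [hc] at this
  exact this

theorem sendovRadius_five_lower : ∃ C : ℝ, ∀ᶠ β : ℝ in 𝓝[≤] 1,
    1 - 3 / 10 * (1 - β) - C * (1 - β) ^ 2 ≤ sendovRadius 5 (β : ℂ) := by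
  obtain ⟨K, hK, h⟩ := norm_sub_extremalQuintic_criticalPoint
  refine ⟨K + 1, ?_⟩
  filter_upwards [eventually_nhdsLE_one (by norm_num : (0 : ℝ) < 1 / 1000000),
    eventually_nhdsLE_one (by positivity : (0 : ℝ) < 1 / (10 * (K + 1)))] with β ⟨h0, h1⟩ ⟨_, h2⟩
  have hmem := extremalQuintic_mem h0 (by linarith)
  rw [sub_sub_cancel] at hmem
  refine le_trans ?_ ((sendovRadius_isLUB 5 (by norm_num) β
    (norm_ofReal_le_one h0 (by linarith))).1 ⟨_, hmem, rfl⟩)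
  refine (Metric.le_infDist (exists_derivative_extremalQuintic_root _)).2 fun z hz => ?_
  rw [dist_eq_norm]
  -- At ε = 0 the rescaling by √ε breaks down, but there P' = 5z⁴ and the distance is 1.
  rcases h0.eq_or_lt with h3 | h3
  · have hz' : (extremalQuintic (1 - β)).derivative.eval z = 0 := hz
    rw [eval_derivative_extremalQuintic, ← h3] at hz'
    have hz0 : z = 0 := by simpa using hz'
    have hβ : β = 1 := by linarith
    simp [hz0, hβ]
  · have h4 := h (1 - β) z h3 h1 hz
    rw [sub_sub_cancel] at h4
    set ε := 1 - β with hε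
    refine abs_le_of_sq_le_sq' (le_trans ?_ h4) (norm_nonneg _) |>.2
    rw [le_div_iff₀ (by positivity)] at h2
    -- Squaring the claimed bound produces (3ε/10 + (K+1)ε²)² ≤ ε²; the surplus of K + 1 over K
    -- absorbs it.
    have h5 : (K + 1) * ε ^ 2 ≤ ε / 10 := by nlinarith
    have h6 : (3 / 10 * ε + (K + 1) * ε ^ 2) ^ 2 ≤ ε ^ 2 :=
      pow_le_pow_left₀ (by positivity) (by linarith) 2
    nlinarith [mul_nonneg hK (sq_nonneg ε)]

/-! ### The main theorem -/

theorem corollary2 :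
    (∀ n : ℕ, 2 ≤ n → ∃ C : ℝ, ∀ᶠ β : ℝ in 𝓝[≤] 1,
      sendovRadius n (β : ℂ) ≤ 1 - 3 / 10 * (1 - β) + C * (1 - β) ^ 2) ∧
    (∃ C : ℝ, ∀ᶠ β : ℝ in 𝓝[≤] 1,
      |sendovRadius 5 (β : ℂ) - (1 - 3 / 10 * (1 - β))| ≤ C * (1 - β) ^ 2) ∧
    (∀ c : ℝ,
      (∀ n : ℕ, 2 ≤ n → ∃ C : ℝ, ∀ᶠ β : ℝ in 𝓝[≤] 1,
        sendovRadius n (β : ℂ) ≤ 1 - c * (1 - β) + C * (1 - β) ^ 2) →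
      c ≤ 3 / 10) := by
  obtain ⟨C₁, h₁⟩ := sendovRadius_upper (n := 5) (by norm_num)
  obtain ⟨C₂, h₂⟩ := sendovRadius_five_lower
  refine ⟨fun n hn => sendovRadius_upper hn, ⟨max C₁ C₂, ?_⟩, fun c hc => ?_⟩
  · filter_upwards [h₁, h₂] with β e₁ e₂
    have f₁ : C₁ * (1 - β) ^ 2 ≤ max C₁ C₂ * (1 - β) ^ 2 :=
      mul_le_mul_of_nonneg_right (le_max_left _ _) (sq_nonneg _)
    have f₂ : C₂ * (1 - β) ^ 2 ≤ max C₁ C₂ * (1 - β) ^ 2 :=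
      mul_le_mul_of_nonneg_right (le_max_right _ _) (sq_nonneg _)
    rw [abs_le]
    constructor <;> linarith
  · obtain ⟨C₃, h₃⟩ := hc 5 (by norm_num)
    -- The point β = 1 is discarded so that the comparison for n = 5 can be divided by 1 - β before
    -- the limit.
    have hlt : (𝓝[<] (1 : ℝ)) ≤ 𝓝[≤] 1 := nhdsWithin_mono _ Set.Iio_subset_Iic_self
    have hev : ∀ᶠ β : ℝ in 𝓝[<] 1, c ≤ 3 / 10 + (C₂ + C₃) * (1 - β) := by
      filter_upwards [h₂.filter_mono hlt, h₃.filter_mono hlt, self_mem_nhdsWithin] with β e₂ e₃ hβ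
      have hpos : 0 < 1 - β := sub_pos.2 hβ
      have : (1 - β) * c ≤ (1 - β) * (3 / 10 + (C₂ + C₃) * (1 - β)) := by linarith
      exact le_of_mul_le_mul_left this hpos
    have hlim : Tendsto (fun β : ℝ => 3 / 10 + (C₂ + C₃) * (1 - β)) (𝓝[<] 1)
        (𝓝 (3 / 10 + (C₂ + C₃) * (1 - 1))) :=
      Continuous.tendsto' (by fun_prop) _ _ rfl |>.mono_left nhdsWithin_le_nhds
    have := ge_of_tendsto hlim hev
    linarith
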